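/- Let $N,d\ge 1$, and let $\mathbf{x}_1,\dots,\mathbf{x}_N\in\mathbb{R}^d$ be a dataset (the labels $y_n=\pm1$ are absorbed into the points, i.e. $y_n\mathbf{x}_n$ is written $\mathbf{x}_n$). For Lebesgue-almost every dataset $(\mathbf{x}_1,\dots,\mathbf{x}_N)\in(\mathbb{R}^d)^N$ the following holds. Assume that the dataset is strictly linearly separable, i.e. some $\mathbf{w}_*$ has $\mathbf{w}_*^\top\mathbf{x}_n>0$ for all $n$. Put $$\gamma=\max_{\|\mathbf{w}\|=1}\min_n\mathbf{w}^\top\mathbf{x}_n ,$$ let $\sigma_{\max}$ be the largest singular value of the $d\times N$ matrix with columns $\mathbf{x}_n$, and let $$\hat{\mathbf{w}}=\operatorname*{argmin}_{\mathbf{w}}\|\mathbf{w}\|^2\ \text{ s.t. }\ \mathbf{w}^\top\mathbf{x}_n\ge1\ \text{ for all } n$$ (which exists and is unique). Let $\ell:\mathbb{R}\to\mathbb{R}$ be differentiable with $\beta$-Lipschitz derivative, $\ell>0$, $\ell'<0$, $\lim_{u\to\infty}\ell(u)=\lim_{u\to\infty}\ell'(u)=0$ and $\limsup_{u\to-\infty}\ell'(u)\ne0$,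 and let $-\ell'$ have a tight exponential tail: there are $\mu_+,\mu_-,\bar u>0$ with $$(1-e^{-\mu_-u})e^{-u}\le-\ell'(u)\le(1+e^{-\mu_+u})e^{-u}\qquad\text{for all } u>\bar u .$$ Let $N=KB$ with integers $K,B\ge1$, let $\eta>0$, let $\mathbf{w}(0)\in\mathbb{R}^d$ be arbitrary, and consider SGD $$\mathbf{w}(t+1)=\mathbf{w}(t)-\frac{\eta}{B}\sum_{n\in\mathcal{B}(t)}\ell'(\mathbf{w}(t)^\top\mathbf{x}_n)\,\mathbf{x}_n$$ with minibatches $\mathcal{B}(t)\subset\{1,\dots,N\}$ of $B$ distinct indices, in one of two regimes: 1. (with replacement) the minibatches $\mathcal{B}(t)$, $t\ge0$, are independent random sets, at each $t$ every index is selected with the same probability $B/N$, and $\dfrac{\eta}{B}<\dfrac{2\gamma^2}{\beta\sigma_{\max}^4}$; 2. (without replacement) $\bigcup_{k=0}^{K-1}\mathcal{B}(Ku+k)=\{1,\dots,N\}$ for every $u\ge0$, and $$\frac{\eta}{B}<\min\left[\frac{1}{2K\beta\sigma_{\max}^2},\ \frac{\gamma}{2\beta\sigma_{\max}^3(K+\gamma^{-1}\sigma_{\max})}\right].$$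 Then, almost surely in case 1 and surely in case 2, $$\mathbf{w}(t)=\hat{\mathbf{w}}\log\left(\frac{\eta}{B}\cdot\frac{t}{K}\right)+\boldsymbol{\rho}(t)\quad(t\ge1),\qquad \sup_t\|\boldsymbol{\rho}(t)\|<\infty .$$ Consequently (almost surely, respectively surely) $\mathbf{w}(t)/\|\mathbf{w}(t)\|\to\hat{\mathbf{w}}/\|\hat{\mathbf{w}}\|$ with $$\left\|\frac{\mathbf{w}(t)}{\|\mathbf{w}(t)\|}-\frac{\hat{\mathbf{w}}}{\|\hat{\mathbf{w}}\|}\right\|=O\left(\frac1{\log t}\right),\qquad \sum_{n=1}^N\ell(\mathbf{w}(t)^\top\mathbf{x}_n)=O\left(\frac1t\right).$$ -/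

import Mathlib

open MeasureTheory ProbabilityTheory Filter Topology Asymptotics
open scoped NNReal ENNReal RealInnerProductSpace

noncomputable section

namespace SGDMaxMargin

/-- The space `ℝ^d` of weight vectors and data points, with the Euclidean norm. -/
abbrev Vec (d : ℕ) : Type := EuclideanSpace ℝ (Fin d)

/-- A dataset of `N` points of `ℝ^d`. The labels `±1` are absorbed into the points
(`y_n x_n` is written `x_n`). Lebesgue measure on `(ℝ^d)^N` is `volume` on this type. -/
abbrev Dataset (N d : ℕ) : Type := Fin N → Vec d

variable {N d : ℕ}

/-- Strict linear separability (by a homogeneous linear predictor). -/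
def LinearlySeparable (x : Dataset N d) : Prop :=
  ∃ w : Vec d, ∀ n, 0 < ⟪w, x n⟫

/-- The maximal `L²` margin `γ = max_{‖w‖ = 1} min_n wᵀ x_n`. -/
def maxMargin (x : Dataset N d) : ℝ :=
  ⨆ w : Metric.sphere (0 : Vec d) 1, ⨅ n, ⟪(w : Vec d), x n⟫

/-- The `d × N` matrix whose columns are the data points. -/
def dataMatrix (x : Dataset N d) : Matrix (Fin d) (Fin N) ℝ :=
  Matrix.of fun i n => x n i

/-- The largest singular value of the data matrix, i.e. its operator norm as a map between
Euclidean spaces. -/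
def sigmaMax (x : Dataset N d) : ℝ :=
  ‖LinearMap.toContinuousLinearMap (Matrix.toEuclideanLin (dataMatrix x))‖

/-- `v` satisfies the hard-margin constraints `vᵀ x_n ≥ 1` for all `n`. -/
def MarginFeasible (x : Dataset N d) (v : Vec d) : Prop :=
  ∀ n, 1 ≤ ⟪v, x n⟫

/-- `v` is a minimizer of `‖v‖²` subject to `vᵀ x_n ≥ 1` for all `n` (hard-margin SVM). -/
def IsHardMarginSVM (x : Dataset N d) (v : Vec d) : Prop :=
  MarginFeasible x v ∧ ∀ u, MarginFeasible x u → ‖v‖ ^ 2 ≤ ‖u‖ ^ 2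

/-- Smooth monotone losses: positive, differentiable, with `β`-Lipschitz derivative,
strictly decreasing to zero, with `limsup_{u → -∞} ℓ'(u) ≠ 0`. The `limsup` is taken in the extended
reals because `ℓ'` may tend to `-∞` there. -/
structure IsSmoothMonotoneLoss (ℓ : ℝ → ℝ) (β : ℝ≥0) : Prop where
  pos : ∀ u, 0 < ℓ u
  differentiable : Differentiable ℝ ℓ
  lipschitz_deriv : LipschitzWith β (deriv ℓ)
  deriv_neg : ∀ u, deriv ℓ u < 0
  tendsto_zero : Tendsto ℓ atTop (𝓝 0)
  tendsto_deriv_zero : Tendsto (deriv ℓ) atTop (𝓝 0)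
  limsup_deriv_ne_zero : limsup (fun u => ((deriv ℓ u : ℝ) : EReal)) atBot ≠ 0

/-- `f` has a tight exponential tail. -/
def HasTightExponentialTail (f : ℝ → ℝ) : Prop :=
  ∃ μp > 0, ∃ μm > 0, ∃ ubar > 0, ∀ u : ℝ, ubar < u →
    (1 - Real.exp (-μm * u)) * Real.exp (-u) ≤ f u ∧
      f u ≤ (1 + Real.exp (-μp * u)) * Real.exp (-u)

/-- The training loss `L(w) = ∑_n ℓ(wᵀ x_n)`. -/
def trainingLoss (ℓ : ℝ → ℝ) (x : Dataset N d) (w : Vec d) : ℝ :=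
  ∑ n, ℓ ⟪w, x n⟫

/-- The SGD iterates `w(t+1) = w(t) - (η/B) ∑_{n ∈ batch t} ℓ'(w(t)ᵀ x_n) x_n`, `w(0) = w₀`. -/
def sgd (ℓ : ℝ → ℝ) (x : Dataset N d) (η : ℝ) (B : ℕ) (batch : ℕ → Finset (Fin N))
    (w₀ : Vec d) : ℕ → Vec d
  | 0 => w₀
  | t + 1 =>
      let w := sgd ℓ x η B batch w₀ t
      w - (η / B) • ∑ n ∈ batch t, deriv ℓ ⟪w, x n⟫ • x n

/-- Random sampling with replacement: the minibatches at different iterations are independent, each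
consists of `B` distinct indices, and at each iteration every sample is selected with the
same probability (which is then `B / N`). -/
structure SamplesWithReplacement {Ω : Type*} [MeasurableSpace Ω] (P : Measure Ω) (B : ℕ)
    (batch : ℕ → Ω → Finset (Fin N)) : Prop where
  measurable : ∀ t s, MeasurableSet {ω | batch t ω = s}
  card_eq : ∀ t ω, (batch t ω).card = B
  indep : iIndepFun (m := fun _ => ⊤) batch P
  uniform : ∀ t n, P.real {ω | n ∈ batch t ω} = (B : ℝ) / N

/-- Sampling without replacement: each minibatch consists of `B` distinct indices, and the `K`
minibatches of each epoch cover (hence, if `N = K * B`, partition) the index set. -/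
structure SamplesWithoutReplacement (B K : ℕ) (batch : ℕ → Finset (Fin N)) : Prop where
  card_eq : ∀ t, (batch t).card = B
  epoch : ∀ u, (Finset.range K).biUnion (fun k => batch (K * u + k)) = Finset.univ

/-- The asymptotic behaviour of a sequence of weights `w(t)`:
`w(t) = log((η/B)·t/K) ŵ + ρ(t)` for `t ≥ 1` with `ρ` bounded; the direction of `w(t)` converges to
that of `ŵ` at rate `O(1 / log t)`; and the training loss is `O(1 / t)`. -/
structure ConvergesToSVM (ℓ : ℝ → ℝ) (x : Dataset N d) (what : Vec d) (η : ℝ) (B K : ℕ)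
    (w : ℕ → Vec d) : Prop where
  expansion : ∃ ρ : ℕ → Vec d, (∃ C : ℝ, ∀ t, ‖ρ t‖ ≤ C) ∧
    ∀ t : ℕ, 1 ≤ t → w t = Real.log (η / B * (t / K)) • what + ρ t
  direction : Tendsto (fun t => ‖w t‖⁻¹ • w t) atTop (𝓝 (‖what‖⁻¹ • what))
  direction_rate : (fun t => ‖w t‖⁻¹ • w t - ‖what‖⁻¹ • what)
    =O[atTop] fun t : ℕ => 1 / Real.log t
  loss_rate : (fun t => trainingLoss ℓ x (w t)) =O[atTop] fun t : ℕ => 1 / (t : ℝ)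

end SGDMaxMargin

end

/-!
Outside a null set of datasets the hard-margin solution `ŵ` has dual weights `α` satisfying strict
complementarity, because a point which is not used to define a candidate solution almost surely does
not lie on its margin hyperplane. Under either sampling regime the training loss descends (along
epochs, or in expectation), which makes `∑ₜ ∑ₙ ℓ'(w(t)ᵀ xₙ)²` finite and drives every margin to
infinity. Up to a bounded correction (the position inside the epoch, or the `L²`-bounded martingale
of the sampling errors), the iterates then follow `v(t+1) = v(t) + ∑ₙ pₙ(t) xₙ` with `pₙ(t)` of
order `exp (-v(t)ᵀ xₙ)`.

Put `r(t) = v(t) - log t • ŵ`. A support vector contributes `(pₙ - αₙ / t) xₙ` to the increments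
of `r`, with `pₙ` of order `exp (-rᵀ xₙ) / t`, which pushes `rᵀ xₙ` back to `O(1)` from both sides.
This first gives `r = o(log t)`; strict complementarity then makes the steps along the other points
summable, and `αₙ > 0` on the support vectors turns the push into a drift `-κ ‖r‖ / t` which bounds
`r`.
-/

namespace SGDMaxMargin

section Geometry

variable {N d : ℕ} {x : Dataset N d}

theorem toEuclideanLin_dataMatrix (x : Dataset N d) (c : Fin N → ℝ) :
    Matrix.toEuclideanLin (dataMatrix x) (WithLp.toLp 2 c) = ∑ n, c n • x n := by
  ext i
  simp [Matrix.toEuclideanLin, dataMatrix, Matrix.mulVec, dotProduct, mul_comm]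

theorem sigmaMax_nonneg (x : Dataset N d) : 0 ≤ sigmaMax x := norm_nonneg _

theorem norm_sum_smul_sq_le (x : Dataset N d) (s : Finset (Fin N)) (c : Fin N → ℝ) :
    ‖∑ n ∈ s, c n • x n‖ ^ 2 ≤ sigmaMax x ^ 2 * ∑ n ∈ s, c n ^ 2 := by
  set c' : Fin N → ℝ := fun n => if n ∈ s then c n else 0 with hc'
  have hop := (LinearMap.toContinuousLinearMap
    (Matrix.toEuclideanLin (dataMatrix x))).le_opNorm (WithLp.toLp 2 c')
  rw [LinearMap.coe_toContinuousLinearMap', toEuclideanLin_dataMatrix] at hop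
  calc ‖∑ n ∈ s, c n • x n‖ ^ 2 = ‖∑ n, c' n • x n‖ ^ 2 := by simp [hc', ite_smul]
    _ ≤ (sigmaMax x * ‖WithLp.toLp 2 c'‖) ^ 2 := by gcongr; exact hop
    _ = sigmaMax x ^ 2 * ∑ n ∈ s, c n ^ 2 := by
        rw [mul_pow, EuclideanSpace.norm_sq_eq]; simp [hc']

theorem sum_inner_sq_le (x : Dataset N d) (w : Vec d) :
    ∑ n, ⟪w, x n⟫ ^ 2 ≤ sigmaMax x ^ 2 * ‖w‖ ^ 2 := by
  set A := LinearMap.toContinuousLinearMap (Matrix.toEuclideanLin (dataMatrix x)) with hA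
  have hcoord : ∀ n, A.adjoint w n = ⟪w, x n⟫ := by
    intro n
    have hAn : A (EuclideanSpace.single n 1) = x n := by
      rw [hA, LinearMap.coe_toContinuousLinearMap', EuclideanSpace.single,
        toEuclideanLin_dataMatrix]
      simp
    rw [real_inner_comm, ← hAn, ← ContinuousLinearMap.adjoint_inner_right,
      EuclideanSpace.inner_single_left]
    simp
  calc ∑ n, ⟪w, x n⟫ ^ 2 = ‖A.adjoint w‖ ^ 2 := by
        simp [EuclideanSpace.norm_sq_eq, hcoord]
    _ ≤ (‖A.adjoint‖ * ‖w‖) ^ 2 := by gcongr; exact A.adjoint.le_opNorm w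
    _ = sigmaMax x ^ 2 * ‖w‖ ^ 2 := by rw [mul_pow, LinearIsometryEquiv.norm_map]; rfl

theorem iInf_inner_le_norm (x : Dataset N d) (w : Metric.sphere (0 : Vec d) 1) (n : Fin N) :
    ⨅ m, ⟪(w : Vec d), x m⟫ ≤ ‖x n‖ :=
  calc ⨅ m, ⟪(w : Vec d), x m⟫ ≤ ⟪(w : Vec d), x n⟫ := ciInf_le (Set.finite_range _).bddBelow n
    _ ≤ ‖(w : Vec d)‖ * ‖x n‖ := real_inner_le_norm _ _
    _ = ‖x n‖ := by simp

theorem maxMargin_pos (hN : 0 < N) (hx : LinearlySeparable x) : 0 < maxMargin x := by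
  obtain ⟨w, hw⟩ := hx
  let n₀ : Fin N := ⟨0, hN⟩
  have : Nonempty (Fin N) := ⟨n₀⟩
  have hw0 : w ≠ 0 := by
    rintro rfl
    simpa using hw n₀
  let u : Metric.sphere (0 : Vec d) 1 := ⟨‖w‖⁻¹ • w, by simp [norm_smul, hw0]⟩
  obtain ⟨n, hn⟩ := exists_eq_ciInf_of_finite (f := fun n => ⟪(u : Vec d), x n⟫)
  calc 0 < ‖w‖⁻¹ * ⟪w, x n⟫ := mul_pos (inv_pos.2 (norm_pos_iff.2 hw0)) (hw n)
    _ = ⨅ n, ⟪(u : Vec d), x n⟫ := by rw [← hn, ← real_inner_smul_left]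
    _ ≤ maxMargin x := le_ciSup (f := fun v : Metric.sphere (0 : Vec d) 1 =>
        ⨅ n, ⟪(v : Vec d), x n⟫)
        ⟨‖x n₀‖, Set.forall_mem_range.2 fun v => iInf_inner_le_norm x v n₀⟩ u

theorem pos_of_maxMargin_pos (hγ : 0 < maxMargin x) : 0 < N := by
  rcases N.eq_zero_or_pos with rfl | hN
  · simp [maxMargin] at hγ
  · exact hN

theorem maxMargin_mul_sum_le (x : Dataset N d) {c : Fin N → ℝ} (hc : ∀ n, 0 ≤ c n) :
    maxMargin x * ∑ n, c n ≤ ‖∑ n, c n • x n‖ := by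
  rcases (Finset.sum_nonneg fun n (_ : n ∈ Finset.univ) => hc n).eq_or_lt with hsum | hsum
  · rw [← hsum]; simp
  rw [← le_div_iff₀ hsum]
  refine Real.iSup_le (fun u => ?_) (by positivity)
  rw [le_div_iff₀ hsum, Finset.mul_sum]
  calc ∑ n, (⨅ n, ⟪(u : Vec d), x n⟫) * c n ≤ ∑ n, ⟪(u : Vec d), x n⟫ * c n := by
        gcongr with n
        · exact hc n
        · exact ciInf_le (Set.finite_range _).bddBelow n
    _ = ⟪(u : Vec d), ∑ n, c n • x n⟫ := by
        simp only [inner_sum, real_inner_smul_right, mul_comm]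
    _ ≤ ‖(u : Vec d)‖ * ‖∑ n, c n • x n‖ := real_inner_le_norm _ _
    _ = ‖∑ n, c n • x n‖ := by simp

theorem maxMargin_sq_mul_sum_sq_le (hγ : 0 ≤ maxMargin x) {c : Fin N → ℝ}
    (hc : ∀ n, 0 ≤ c n) : maxMargin x ^ 2 * ∑ n, c n ^ 2 ≤ ‖∑ n, c n • x n‖ ^ 2 :=
  calc maxMargin x ^ 2 * ∑ n, c n ^ 2 ≤ maxMargin x ^ 2 * (∑ n, c n) ^ 2 := by
        gcongr; exact Finset.sum_sq_le_sq_sum_of_nonneg fun n _ => hc n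
    _ = (maxMargin x * ∑ n, c n) ^ 2 := by ring
    _ ≤ ‖∑ n, c n • x n‖ ^ 2 :=
        pow_le_pow_left₀ (mul_nonneg hγ (Finset.sum_nonneg fun n _ => hc n))
          (maxMargin_mul_sum_le x hc) 2

theorem sigmaMax_pos (hγ : 0 < maxMargin x) : 0 < sigmaMax x := by
  refine (sigmaMax_nonneg x).lt_of_ne' fun hσ => ?_
  have hlower := maxMargin_sq_mul_sum_sq_le hγ.le (c := fun _ => 1) fun _ => zero_le_one
  have hupper := norm_sum_smul_sq_le x Finset.univ fun _ => 1
  have hN : (0 : ℝ) < N := Nat.cast_pos.2 (pos_of_maxMargin_pos hγ)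
  have hpos : 0 < maxMargin x ^ 2 * N := by positivity
  simp only [hσ, one_pow, Finset.sum_const, Finset.card_univ, Fintype.card_fin, nsmul_eq_mul,
    mul_one] at hlower hupper
  linarith

end Geometry

section KKT

variable {ι E : Type*} [Fintype ι] [NormedAddCommGroup E] [InnerProductSpace ℝ E]
  {x : ι → E} {w u : E} {α c : ι → ℝ}

/-- The Karush–Kuhn–Tucker conditions of the problem `min ‖w‖²` subject to `⟪w, x n⟫ ≥ 1`, with
`α` the vector of (halved) Lagrange multipliers. -/
structure IsKKTPair (x : ι → E) (w : E) (α : ι → ℝ) : Prop where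
  feasible : ∀ n, 1 ≤ ⟪w, x n⟫
  nonneg : ∀ n, 0 ≤ α n
  stationary : w = ∑ n, α n • x n
  slack : ∀ n, α n = 0 ∨ ⟪w, x n⟫ = 1

/-- A KKT pair with strict complementarity: exactly one of `α n` and the slack of the `n`-th
constraint vanishes, so the points with nonzero weight are exactly the support vectors. -/
structure IsStrictKKTPair (x : ι → E) (w : E) (α : ι → ℝ) : Prop extends IsKKTPair x w α where
  strict : ∀ n, α n = 0 → 1 < ⟪w, x n⟫

theorem IsKKTPair.norm_sq_eq (h : IsKKTPair x w α) : ‖w‖ ^ 2 = ∑ n, α n := by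
  rw [← real_inner_self_eq_norm_sq]
  nth_rewrite 2 [h.stationary]
  rw [inner_sum]
  refine Finset.sum_congr rfl fun n _ => ?_
  rw [real_inner_smul_right]
  rcases h.slack n with hα | hw
  · simp [hα]
  · simp [hw]

theorem IsKKTPair.norm_sq_add_norm_sub_sq_le (h : IsKKTPair x w α) (hu : ∀ n, 1 ≤ ⟪u, x n⟫) :
    ‖w‖ ^ 2 + ‖u - w‖ ^ 2 ≤ ‖u‖ ^ 2 := by
  have hinner : ‖w‖ ^ 2 ≤ ⟪u, w⟫ :=
    calc ‖w‖ ^ 2 = ∑ n, α n := h.norm_sq_eq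
      _ ≤ ∑ n, α n * ⟪u, x n⟫ :=
          Finset.sum_le_sum fun n _ => le_mul_of_one_le_right (h.nonneg n) (hu n)
      _ = ⟪u, w⟫ := by rw [h.stationary]; simp only [inner_sum, real_inner_smul_right]
  linarith [norm_sub_sq_real u w]

/-- Half the squared norm minus the total weight of a combination of the points: minimizing it over
nonnegative weights is the Lagrange dual of the hard-margin problem. -/
noncomputable def dualObjective (x : ι → E) (c : ι → ℝ) : ℝ :=
  ‖∑ n, c n • x n‖ ^ 2 / 2 - ∑ n, c n

theorem dualObjective_nonneg_of_two_div_sq_le_norm {γ : ℝ} (hγ : 0 < γ) (hc : 0 ≤ c)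
    (hmargin : γ * ∑ n, c n ≤ ‖∑ n, c n • x n‖) (hnorm : 2 / γ ^ 2 ≤ ‖c‖) :
    0 ≤ dualObjective x c := by
  have hsum : 0 ≤ ∑ n, c n := Finset.sum_nonneg fun n _ => hc n
  have hle : ‖c‖ ≤ ∑ n, c n := by
    refine (pi_norm_le_iff_of_nonneg hsum).2 fun n => ?_
    rw [Real.norm_of_nonneg (hc n)]
    exact Finset.single_le_sum (fun m _ => hc m) (Finset.mem_univ n)
  have hlarge : 2 ≤ (∑ n, c n) * γ ^ 2 := (div_le_iff₀ (by positivity)).1 (hnorm.trans hle)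
  have hsq : (γ * ∑ n, c n) ^ 2 ≤ ‖∑ n, c n • x n‖ ^ 2 := by gcongr
  rw [dualObjective]
  nlinarith

theorem exists_isMinOn_dualObjective {γ : ℝ} (hγ : 0 < γ)
    (hmargin : ∀ c : ι → ℝ, 0 ≤ c → γ * ∑ n, c n ≤ ‖∑ n, c n • x n‖) :
    ∃ α, 0 ≤ α ∧ IsMinOn (dualObjective x) (Set.Ici 0) α := by
  have hcont : Continuous (dualObjective x) := by unfold dualObjective; fun_prop
  obtain ⟨α, hα, hmin⟩ := hcont.continuousOn.exists_isMinOn' isClosed_Ici (x₀ := 0)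
    (Set.mem_Ici.2 le_rfl) (by
      filter_upwards [(tendsto_norm_cocompact_atTop.eventually_ge_atTop (2 / γ ^ 2)).filter_mono
        inf_le_left, mem_inf_of_right (mem_principal_self _)] with c hnorm hc
      have hzero : dualObjective x 0 = 0 := by simp [dualObjective]
      rw [hzero]
      exact dualObjective_nonneg_of_two_div_sq_le_norm hγ hc (hmargin c hc) hnorm)
  exact ⟨α, hα, hmin⟩

theorem dualObjective_add_single [DecidableEq ι] (x : ι → E) (c : ι → ℝ) (n : ι) (t : ℝ) :
    dualObjective x (c + Pi.single n t : ι → ℝ) = dualObjective x c +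
      (t * (⟪∑ m, c m • x m, x n⟫ - 1) + t ^ 2 * (‖x n‖ ^ 2 / 2)) := by
  have hcomb : ∑ m, (c + Pi.single n t : ι → ℝ) m • x m = ∑ m, c m • x m + t • x n := by
    simp [add_smul, Finset.sum_add_distrib, Pi.single_apply]
  have hsum : ∑ m, (c + Pi.single n t : ι → ℝ) m = ∑ m, c m + t := by
    simp [Finset.sum_add_distrib]
  rw [dualObjective, dualObjective, hcomb, hsum, norm_add_sq_real, inner_smul_right, norm_smul,
    mul_pow, Real.norm_eq_abs, sq_abs]
  ring

theorem nonneg_of_eventually_nonneg_add_sq {a b : ℝ}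
    (h : ∀ᶠ t in 𝓝[>] (0 : ℝ), 0 ≤ t * a + t ^ 2 * b) : 0 ≤ a := by
  have hlim : Tendsto (fun t : ℝ => a + t * b) (𝓝[>] 0) (𝓝 a) :=
    (Continuous.tendsto' (by fun_prop) 0 a (by simp)).mono_left nhdsWithin_le_nhds
  refine ge_of_tendsto hlim ?_
  filter_upwards [h, self_mem_nhdsWithin] with t ht hpos
  have hfactor : 0 ≤ t * (a + t * b) := by linarith
  exact nonneg_of_mul_nonneg_right hfactor hpos

theorem isKKTPair_of_isMinOn_dualObjective (hα : 0 ≤ α)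
    (hmin : IsMinOn (dualObjective x) (Set.Ici 0) α) : IsKKTPair x (∑ n, α n • x n) α := by
  classical
  have hvar : ∀ n t, -α n ≤ t →
      0 ≤ t * (⟪∑ m, α m • x m, x n⟫ - 1) + t ^ 2 * (‖x n‖ ^ 2 / 2) := by
    intro n t ht
    have hmem : α + Pi.single n t ∈ Set.Ici (0 : ι → ℝ) := by
      intro m
      rcases eq_or_ne m n with rfl | hne
      · simpa using neg_le_iff_add_nonneg'.1 ht
      · simpa [hne] using hα m
    have hle := isMinOn_iff.1 hmin _ hmem
    rw [dualObjective_add_single] at hle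
    linarith
  have hfeasible : ∀ n, 1 ≤ ⟪∑ m, α m • x m, x n⟫ := fun n => by
    refine sub_nonneg.1 (nonneg_of_eventually_nonneg_add_sq (b := ‖x n‖ ^ 2 / 2) ?_)
    filter_upwards [self_mem_nhdsWithin] with t ht
    exact hvar n t ((neg_nonpos.2 (hα n)).trans (le_of_lt ht))
  refine ⟨hfeasible, hα, rfl, fun n => or_iff_not_imp_left.2 fun hne => ?_⟩
  refine le_antisymm (sub_nonneg.1
    (nonneg_of_eventually_nonneg_add_sq (b := ‖x n‖ ^ 2 / 2) ?_)) (hfeasible n)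
  filter_upwards [Ioc_mem_nhdsGT ((hα n).lt_of_ne' hne)] with t ht
  have := hvar n (-t) (neg_le_neg ht.2)
  linarith

theorem exists_isKKTPair {γ : ℝ} (hγ : 0 < γ)
    (hmargin : ∀ c : ι → ℝ, 0 ≤ c → γ * ∑ n, c n ≤ ‖∑ n, c n • x n‖) :
    ∃ w α, IsKKTPair x w α :=
  let ⟨α, hα, hmin⟩ := exists_isMinOn_dualObjective hγ hmargin
  ⟨_, α, isKKTPair_of_isMinOn_dualObjective hα hmin⟩

end KKT

theorem exists_nonneg_sub_mul {ι 𝕜 : Type*} [Finite ι] [Field 𝕜] [LinearOrder 𝕜]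
    [IsStrictOrderedRing 𝕜] {a c : ι → 𝕜} (ha : 0 ≤ a) (hc : ∃ n, 0 < c n) :
    ∃ t, (∀ n, 0 ≤ a n - t * c n) ∧ ∃ m, 0 < c m ∧ a m - t * c m = 0 := by
  cases nonempty_fintype ι
  obtain ⟨n₀, hn₀⟩ := hc
  obtain ⟨m, hm, hmin⟩ := (Finset.univ.filter fun n => 0 < c n).exists_min_image
    (fun n => a n / c n) ⟨n₀, by simpa using hn₀⟩
  simp only [Finset.mem_filter, Finset.mem_univ, true_and] at hm hmin
  have ht : 0 ≤ a m / c m := div_nonneg (ha m) hm.le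
  refine ⟨a m / c m, fun n => sub_nonneg.2 ?_, m, hm, by field_simp; simp⟩
  rcases le_or_gt (c n) 0 with hn | hn
  · exact (mul_nonpos_of_nonneg_of_nonpos ht hn).trans (ha n)
  · exact (le_div_iff₀ hn).1 (hmin n hn)

section Caratheodory

variable {ι 𝕜 V : Type*} [Fintype ι] [Field 𝕜] [LinearOrder 𝕜] [IsStrictOrderedRing 𝕜]
  [AddCommGroup V] [Module 𝕜 V] {x : ι → V} {a : ι → 𝕜}

theorem exists_relation_of_not_linearIndepOn {s : Set ι} (h : ¬ LinearIndepOn 𝕜 x s) :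
    ∃ c : ι → 𝕜, ∑ n, c n • x n = 0 ∧ Function.support c ⊆ s ∧ ∃ n, 0 < c n := by
  simp only [linearIndepOn_iff, not_forall, exists_prop] at h
  obtain ⟨l, hl, hzero, hne⟩ := h
  rw [Finsupp.linearCombination_apply, Finsupp.sum_fintype _ _ (by simp)] at hzero
  have hsupp : Function.support l ⊆ s := by
    simpa [Finsupp.mem_supported] using hl
  obtain ⟨n, hn⟩ := Finsupp.ne_iff.1 hne
  rcases lt_or_gt_of_ne hn with hneg | hpos
  · exact ⟨-l, by simpa using hzero, by simpa using hsupp, n, by simpa using hneg⟩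
  · exact ⟨l, hzero, hsupp, n, hpos⟩

theorem exists_nonneg_support_ssubset (ha : 0 ≤ a)
    (hdep : ¬ LinearIndepOn 𝕜 x (Function.support a)) :
    ∃ a' : ι → 𝕜, 0 ≤ a' ∧ ∑ n, a' n • x n = ∑ n, a n • x n ∧
      Function.support a' ⊂ Function.support a := by
  obtain ⟨c, hrel, hsupp, hpos⟩ := exists_relation_of_not_linearIndepOn hdep
  obtain ⟨t, hnonneg, m, hcm, hzero⟩ := exists_nonneg_sub_mul ha hpos
  have hac : ∀ n, a n = 0 → c n = 0 := fun n hn => by_contra fun hcn => hsupp hcn hn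
  refine ⟨fun n => a n - t * c n, hnonneg, ?_, ?_⟩
  · simp only [sub_smul, Finset.sum_sub_distrib, mul_smul, ← Finset.smul_sum, hrel, smul_zero,
      sub_zero]
  · have hsub : (Function.support fun n => a n - t * c n) ⊆ Function.support a :=
      fun n hn (han : a n = 0) => hn (by simp [han, hac n han])
    exact (Set.ssubset_iff_of_subset hsub).2 ⟨m, hsupp hcm.ne', by simpa⟩

theorem exists_nonneg_linearIndepOn_support (ha : 0 ≤ a) :
    ∃ a' : ι → 𝕜, 0 ≤ a' ∧ ∑ n, a' n • x n = ∑ n, a n • x n ∧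
      Function.support a' ⊆ Function.support a ∧ LinearIndepOn 𝕜 x (Function.support a') := by
  induction hs : Function.support a using WellFoundedLT.induction generalizing a with
  | _ s ih =>
    subst hs
    by_cases hdep : LinearIndepOn 𝕜 x (Function.support a)
    · exact ⟨a, ha, rfl, subset_rfl, hdep⟩
    · obtain ⟨b, hb, hba, hss⟩ := exists_nonneg_support_ssubset ha hdep
      obtain ⟨a', ha', ha'b, hsub, hli⟩ := ih _ hss hb rfl
      exact ⟨a', ha', ha'b.trans hba, hsub.trans hss.subset, hli⟩

end Caratheodory

section GenericDatasets

section SupportVec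

variable {ι E : Type*} [DecidableEq ι] [NormedAddCommGroup E] [InnerProductSpace ℝ E]

/-- The vector in the span of the points indexed by `T` having inner product one with each of them,
when these points are linearly independent. -/
noncomputable def supportVec (x : ι → E) (T : Finset ι) : E :=
  ∑ m : T, ((Matrix.gram ℝ fun n : T => x n)⁻¹.mulVec fun _ => 1) m • x m

theorem supportVec_congr {x y : ι → E} {T : Finset ι} (h : ∀ n ∈ T, x n = y n) :
    supportVec x T = supportVec y T := by
  have hrestrict : (fun n : T => x n) = fun n : T => y n := funext fun n => h n n.2
  simp only [supportVec, hrestrict]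
  exact Finset.sum_congr rfl fun n _ => by rw [h n n.2]

theorem eq_supportVec {x : ι → E} {T : Finset ι} {w : E} {α : ι → ℝ}
    (hli : LinearIndepOn ℝ x (T : Set ι)) (hw : w = ∑ n ∈ T, α n • x n)
    (hone : ∀ n ∈ T, ⟪w, x n⟫ = 1) : w = supportVec x T := by
  have hw' : w = ∑ m : T, α m • x m := by
    rw [hw, ← Finset.sum_coe_sort T]
  have hgram : (Matrix.gram ℝ fun n : T => x n).mulVec (fun m => α m) = fun _ => 1 := by
    ext m
    rw [← hone m m.2, hw', sum_inner]
    simp only [Matrix.mulVec, dotProduct, Matrix.gram_apply]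
    exact Finset.sum_congr rfl fun j _ => by
      rw [real_inner_smul_left, real_inner_comm, mul_comm]
  have hdet : IsUnit (Matrix.gram ℝ fun n : T => x n).det :=
    isUnit_iff_ne_zero.2 (Matrix.det_gram_ne_zero_iff_linearIndependent.2 hli)
  rw [hw', supportVec, ← hgram, Matrix.mulVec_mulVec, Matrix.nonsing_inv_mul _ hdet,
    Matrix.one_mulVec]

theorem measurable_supportVec [MeasurableSpace E] [BorelSpace E] [SecondCountableTopology E]
    [Countable ι] (T : Finset ι) : Measurable fun x : ι → E => supportVec x T := by
  have hgram : Continuous fun x : ι → E => Matrix.gram ℝ fun n : T => x n :=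
    continuous_matrix fun i j => by simp only [Matrix.gram_apply]; fun_prop
  have hinv : ∀ i j : T, Measurable fun x : ι → E => (Matrix.gram ℝ fun n : T => x n)⁻¹ i j := by
    intro i j
    simp only [Matrix.inv_def, Ring.inverse_eq_inv', Matrix.smul_apply, smul_eq_mul]
    exact hgram.matrix_det.measurable.inv.mul
      (hgram.matrix_adjugate.matrix_elem i j).measurable
  unfold supportVec
  refine Finset.measurable_sum _ fun m _ =>
    Measurable.smul (f := fun x : ι → E => ((Matrix.gram ℝ fun n : T => x n)⁻¹.mulVec
      fun _ => 1) m) (g := fun x : ι → E => x m) ?_ (measurable_pi_apply _)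
  simp only [Matrix.mulVec, dotProduct, mul_one]
  exact Finset.measurable_sum _ fun j _ => hinv m j

end SupportVec

theorem measure_setOf_inner_eq {E : Type*} [NormedAddCommGroup E] [InnerProductSpace ℝ E]
    [FiniteDimensional ℝ E] [MeasurableSpace E] [BorelSpace E] (μ : Measure E)
    [μ.IsAddHaarMeasure] (u : E) {c : ℝ} (hc : c ≠ 0) : μ {v : E | ⟪u, v⟫ = c} = 0 := by
  let A : AffineSubspace ℝ E := (AffineSubspace.mk' c ⊥).comap (innerₛₗ ℝ u).toAffineMap
  have hA : (A : Set E) = {v : E | ⟪u, v⟫ = c} := by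
    ext v
    simp [A, AffineSubspace.mem_mk', sub_eq_zero]
  rw [← hA]
  refine Measure.addHaar_affineSubspace _ _ fun htop => ?_
  have hzero : (0 : E) ∈ (A : Set E) := by rw [htop]; trivial
  rw [hA] at hzero
  exact hc (by simpa using hzero.symm)

variable {N d : ℕ}

-- Fubini in the `n`-th point: `supportVec x T` does not depend on it.
theorem ae_inner_supportVec_ne_one (T : Finset (Fin N)) {n : Fin N} (hn : n ∉ T) :
    ∀ᵐ x : Dataset N d, ⟪supportVec x T, x n⟫ ≠ 1 := by
  obtain _ | k := N
  · exact n.elim0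
  have hmeas : MeasurableSet {x : Dataset (k + 1) d | ⟪supportVec x T, x n⟫ = 1} :=
    measurableSet_eq_fun ((measurable_supportVec T).inner (measurable_pi_apply n))
      measurable_const
  have hmp := (volume_preserving_piFinSuccAbove (fun _ : Fin (k + 1) => Vec d) n).symm
  simp only [ae_iff, ne_eq, not_not]
  rw [← hmp.measure_preimage hmeas.nullMeasurableSet]
  change (volume.prod volume) _ = 0
  rw [Measure.prod_apply_symm (hmp.measurable hmeas)]
  refine lintegral_eq_zero_of_ae_eq_zero (Eventually.of_forall fun y => ?_)
  refine Eq.trans (congrArg _ ?_)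
    (measure_setOf_inner_eq volume (supportVec (n.insertNth 0 y : Dataset (k + 1) d) T) one_ne_zero)
  ext v
  have hcongr : supportVec (n.insertNth v y : Dataset (k + 1) d) T =
      supportVec (n.insertNth 0 y : Dataset (k + 1) d) T := by
    refine supportVec_congr fun m hm => ?_
    obtain ⟨j, rfl⟩ := Fin.exists_succAbove_eq (ne_of_mem_of_not_mem hm hn)
    simp
  simp [MeasurableEquiv.piFinSuccAbove, Fin.insertNthEquiv, hcongr]

end GenericDatasets

section HardMargin

variable {N d : ℕ} {x : Dataset N d} {w u : Vec d} {α : Fin N → ℝ}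

theorem IsKKTPair.isHardMarginSVM (h : IsKKTPair x w α) : IsHardMarginSVM x w :=
  ⟨h.feasible, fun u hu => by
    linarith [h.norm_sq_add_norm_sub_sq_le hu, sq_nonneg ‖u - w‖]⟩

theorem IsKKTPair.eq_of_isHardMarginSVM (h : IsKKTPair x w α) (hu : IsHardMarginSVM x u) :
    u = w := by
  have hle : ‖u - w‖ ^ 2 ≤ 0 := by
    linarith [h.norm_sq_add_norm_sub_sq_le hu.1, hu.2 w h.feasible]
  exact sub_eq_zero.1 (norm_eq_zero.1 (pow_eq_zero_iff two_ne_zero |>.1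
    (hle.antisymm (sq_nonneg _))))

theorem exists_isKKTPair_of_maxMargin_pos (hγ : 0 < maxMargin x) : ∃ w α, IsKKTPair x w α :=
  exists_isKKTPair hγ fun _ hc => maxMargin_mul_sum_le x hc

theorem existsUnique_isHardMarginSVM (hγ : 0 < maxMargin x) : ∃! w, IsHardMarginSVM x w := by
  obtain ⟨w, α, h⟩ := exists_isKKTPair_of_maxMargin_pos hγ
  exact ⟨w, h.isHardMarginSVM, fun _ => h.eq_of_isHardMarginSVM⟩

theorem IsKKTPair.exists_linearIndepOn (h : IsKKTPair x w α) :
    ∃ α', IsKKTPair x w α' ∧ LinearIndepOn ℝ x (Function.support α') := by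
  obtain ⟨α', hα', hcomb, hsupp, hli⟩ :=
    exists_nonneg_linearIndepOn_support (x := x) (a := α) h.nonneg
  refine ⟨α', ⟨h.feasible, hα', h.stationary.trans hcomb.symm, fun n => ?_⟩, hli⟩
  exact or_iff_not_imp_left.2 fun hn => (h.slack n).resolve_left (hsupp hn)

theorem IsKKTPair.isStrictKKTPair (h : IsKKTPair x w α)
    (hli : LinearIndepOn ℝ x (Function.support α))
    (hgen : ∀ (T : Finset (Fin N)) (n : Fin N), n ∉ T → ⟪supportVec x T, x n⟫ ≠ 1) :
    IsStrictKKTPair x w α := by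
  let T := Finset.univ.filter fun n => α n ≠ 0
  have hw : w = supportVec x T := by
    refine eq_supportVec (α := α) ?_ ?_ fun n hn =>
      (h.slack n).resolve_left (Finset.mem_filter.1 hn).2
    · simpa [T, Function.support] using hli
    · rw [h.stationary, Finset.sum_filter_of_ne fun n _ hne => left_ne_zero_of_smul hne]
  refine ⟨h, fun n hn => (h.feasible n).lt_of_ne' ?_⟩
  rw [hw]
  exact hgen T n (by simpa [T] using hn)

theorem ae_exists_isStrictKKTPair :
    ∀ᵐ x : Dataset N d, 0 < maxMargin x → ∀ w, IsHardMarginSVM x w →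
      ∃ α, IsStrictKKTPair x w α := by
  have hgen : ∀ᵐ x : Dataset N d, ∀ (T : Finset (Fin N)) (n : Fin N), n ∉ T →
      ⟪supportVec x T, x n⟫ ≠ 1 :=
    ae_all_iff.2 fun T => ae_all_iff.2 fun _ => eventually_imp_distrib_left.2
      (ae_inner_supportVec_ne_one T)
  filter_upwards [hgen] with x hgen hγ u hu
  obtain ⟨w, α₀, h₀⟩ := exists_isKKTPair_of_maxMargin_pos hγ
  obtain rfl := h₀.eq_of_isHardMarginSVM hu
  obtain ⟨α, hα, hli⟩ := h₀.exists_linearIndepOn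
  exact ⟨α, hα.isStrictKKTPair hli hgen⟩

end HardMargin

section Sequences

theorem exists_forall_le_of_step {V h : ℕ → ℝ} {A : ℝ} (hh : Summable h) (h0 : ∀ t, 0 ≤ h t)
    (hV : ∀ᶠ t in atTop, V (t + 1) ≤ V t + h t ∨ V (t + 1) ≤ A) : ∃ B, ∀ t, V t ≤ B := by
  obtain ⟨T, hT⟩ := eventually_atTop.1 hV
  have hsum : ∀ t, 0 ≤ ∑ s ∈ Finset.range t, h s := fun t => Finset.sum_nonneg fun s _ => h0 s
  have htail : ∀ t, T ≤ t → V t ≤ max A (V T) + ∑ s ∈ Finset.range t, h s := by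
    intro t ht
    induction t, ht using Nat.le_induction with
    | base => linarith [le_max_right A (V T), hsum T]
    | succ t ht ih =>
      rw [Finset.sum_range_succ]
      rcases hT t ht with hstep | hle
      · linarith
      · linarith [le_max_left A (V T), hsum t, h0 t]
  obtain ⟨B, hB⟩ := ((Set.finite_Iio T).image V).bddAbove
  refine ⟨max B (max A (V T) + ∑' s, h s), fun t => ?_⟩
  rcases lt_or_ge t T with ht | ht
  · exact le_max_of_le_left (hB ⟨t, ht, rfl⟩)
  · exact le_max_of_le_right ((htail t ht).trans
      (by gcongr; exact hh.sum_le_tsum _ fun s _ => h0 s))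

/-- The increment `log (t + 1) - log t`, with the junk value `0` at `t = 0`. -/
noncomputable def logStep (t : ℕ) : ℝ := Real.log (t + 1 : ℕ) - Real.log t

theorem logStep_nonneg (t : ℕ) : 0 ≤ logStep t := by
  rcases t.eq_zero_or_pos with rfl | ht
  · simp [logStep]
  · exact sub_nonneg.2 (Real.log_le_log (by positivity) (by push_cast; linarith))

theorem logStep_le_one_div (t : ℕ) : logStep t ≤ 1 / t := by
  rcases t.eq_zero_or_pos with rfl | ht
  · simp [logStep]
  · rw [logStep, ← Real.log_div (by positivity) (by positivity)]
    calc Real.log ((t + 1 : ℕ) / t) ≤ (t + 1 : ℕ) / t - 1 :=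
          Real.log_le_sub_one_of_pos (by positivity)
      _ = 1 / t := by push_cast; field_simp; ring

theorem one_div_le_two_mul_logStep {t : ℕ} (ht : 1 ≤ t) : 1 / (t : ℝ) ≤ 2 * logStep t := by
  have ht' : (1 : ℝ) ≤ t := by exact_mod_cast ht
  have hlog : Real.log (t / (t + 1 : ℕ)) ≤ t / (t + 1 : ℕ) - 1 :=
    Real.log_le_sub_one_of_pos (by positivity)
  rw [Real.log_div (by positivity) (by positivity)] at hlog
  calc 1 / (t : ℝ) ≤ 2 * (1 - t / (t + 1 : ℕ)) := by
        push_cast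
        rw [one_sub_div (by positivity), mul_div_assoc', div_le_div_iff₀ (by positivity)
          (by positivity)]
        linarith
    _ ≤ 2 * logStep t := by rw [logStep]; linarith

theorem summable_sq_logStep : Summable fun t : ℕ => logStep t ^ 2 := by
  refine Summable.of_nonneg_of_le (fun t => sq_nonneg _) (fun t => ?_)
    (Real.summable_one_div_nat_pow.2 one_lt_two)
  rw [← one_div_pow]
  exact pow_le_pow_left₀ (logStep_nonneg t) (logStep_le_one_div t) 2

theorem summable_sub_mul_sq {ι : Type*} {p δ : ι → ℝ} (hp : Summable fun t => p t ^ 2)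
    (hδ : Summable fun t => δ t ^ 2) (a : ℝ) : Summable fun t => (p t - δ t * a) ^ 2 := by
  refine Summable.of_nonneg_of_le (fun _ => sq_nonneg _) (fun t => ?_)
    ((hp.mul_left 2).add (hδ.mul_left (2 * a ^ 2)))
  linarith [sq_nonneg (p t + δ t * a)]

theorem tendsto_log_natCast_atTop : Tendsto (fun t : ℕ => Real.log t) atTop atTop :=
  Real.tendsto_log_atTop.comp tendsto_natCast_atTop_atTop

variable {E : Type*} [NormedAddCommGroup E] [InnerProductSpace ℝ E] {s : ℕ → E} {G κ : ℝ}

theorem norm_succ_sq (s : ℕ → E) (t : ℕ) :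
    ‖s (t + 1)‖ ^ 2 = ‖s t‖ ^ 2 + 2 * ⟪s t, s (t + 1) - s t⟫ + ‖s (t + 1) - s t‖ ^ 2 := by
  rw [← norm_add_sq_real, add_sub_cancel]

theorem isLittleO_log_of_inner_step_le (hsum : Summable fun t => ‖s (t + 1) - s t‖ ^ 2)
    (hdrift : ∀ᶠ t : ℕ in atTop, ⟪s t, s (t + 1) - s t⟫ ≤ G / t) :
    s =o[atTop] fun t : ℕ => Real.log t := by
  have hlog := tendsto_log_natCast_atTop
  obtain ⟨B, hB⟩ := exists_forall_le_of_step (V := fun t => ‖s t‖ ^ 2 - 4 * |G| * Real.log t)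
    (A := 0) hsum (fun _ => sq_nonneg _) (by
      filter_upwards [hdrift, eventually_ge_atTop 1] with t ht ht1
      have hG : G / t ≤ |G| * (2 * logStep t) := by
        rw [div_eq_mul_one_div]
        exact mul_le_mul (le_abs_self G) (one_div_le_two_mul_logStep ht1) (by positivity)
          (abs_nonneg G)
      rw [logStep] at hG
      left
      linarith [norm_succ_sq s t])
  have hsq : (fun t => ‖s t‖ ^ 2) =O[atTop] fun t : ℕ => Real.log t := by
    refine IsBigO.of_bound (|B| + 4 * |G|) ?_
    filter_upwards [hlog.eventually_ge_atTop 1] with t ht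
    rw [Real.norm_of_nonneg (sq_nonneg _), Real.norm_of_nonneg (by linarith)]
    nlinarith [hB t, le_abs_self B, abs_nonneg B]
  have hlog_sq : (fun t : ℕ => Real.log t) =o[atTop] fun t : ℕ => Real.log t ^ 2 := by
    simpa [Function.comp_def] using
      (isLittleO_pow_pow_atTop_of_lt (𝕜 := ℝ) one_lt_two).comp_tendsto hlog
  exact ((hsq.trans_isLittleO hlog_sq).of_pow two_ne_zero).of_norm_left

theorem exists_norm_le_of_inner_step_le (hκ : 0 < κ)
    (hsum : Summable fun t => ‖s (t + 1) - s t‖ ^ 2)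
    (hdrift : ∀ᶠ t : ℕ in atTop, ⟪s t, s (t + 1) - s t⟫ ≤ (G - κ * ‖s t‖) / t) :
    ∃ R, ∀ t, ‖s t‖ ≤ R := by
  obtain ⟨B, hB⟩ := exists_forall_le_of_step (V := fun t => ‖s t‖ ^ 2)
    (A := 2 * (G / κ) ^ 2 + 2 * ∑' t, ‖s (t + 1) - s t‖ ^ 2) hsum (fun _ => sq_nonneg _) (by
      filter_upwards [hdrift] with t ht
      rcases le_total (G / κ) ‖s t‖ with hlarge | hsmall
      · left
        have hnonpos : (G - κ * ‖s t‖) / t ≤ 0 := div_nonpos_of_nonpos_of_nonneg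
          (by linarith [(div_le_iff₀' hκ).1 hlarge]) (Nat.cast_nonneg t)
        linarith [norm_succ_sq s t]
      · right
        calc ‖s (t + 1)‖ ^ 2 ≤ (‖s t‖ + ‖s (t + 1) - s t‖) ^ 2 := by
              gcongr; exact norm_le_norm_add_norm_sub' _ _
          _ ≤ 2 * ‖s t‖ ^ 2 + 2 * ‖s (t + 1) - s t‖ ^ 2 := by
              linarith [add_sq_le (a := ‖s t‖) (b := ‖s (t + 1) - s t‖)]
          _ ≤ _ := by
              gcongr
              exact hsum.le_tsum t fun _ _ => sq_nonneg _)
  exact ⟨√B, fun t => Real.le_sqrt_of_sq_le (hB t)⟩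

end Sequences

section Drift

theorem mul_le_of_le_mul_exp_neg {p b z : ℝ} (hp : 0 ≤ p) (hle : p ≤ b * Real.exp (-z)) :
    p * z ≤ b := by
  have hb : 0 ≤ b := nonneg_of_mul_nonneg_left (hp.trans hle) (Real.exp_pos _)
  rcases le_total z 0 with hz | hz
  · exact (mul_nonpos_of_nonneg_of_nonpos hp hz).trans hb
  · calc p * z ≤ b * Real.exp (-z) * Real.exp z := by
          gcongr; linarith [Real.add_one_le_exp z]
      _ = b := by rw [mul_assoc, ← Real.exp_add, neg_add_cancel, Real.exp_zero, mul_one]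

theorem mul_le_neg_mul_sq_of_mul_exp_neg_le {p b z : ℝ} (hb : 0 ≤ b) (hz : z ≤ 0)
    (hle : b * Real.exp (-z) ≤ p) : p * z ≤ -(b * z ^ 2) :=
  calc p * z ≤ b * -z * z := by
        refine mul_le_mul_of_nonpos_right (le_trans ?_ hle) hz
        gcongr
        linarith [Real.add_one_le_exp (-z)]
    _ = -(b * z ^ 2) := by ring

-- Both signs of `z` are pushed back to zero: for `z ≥ 0` by the term `δ * a`, for `z ≤ 0` by `p`.
theorem sub_mul_le_of_mul_exp_neg_le {c C a p z δ i : ℝ} (hc : 0 < c) (ha : 0 ≤ a) (hi : 0 ≤ i)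
    (hlow : c * i * Real.exp (-z) ≤ p) (hup : p ≤ C * i * Real.exp (-z)) (hδ : i ≤ 2 * δ)
    (hδ' : δ ≤ i) : (p - δ * a) * z ≤ (C + a ^ 2 / c - a / 2 * |z|) * i := by
  have hp : 0 ≤ p := le_trans (by positivity) hlow
  have hCi : 0 ≤ C * i := nonneg_of_mul_nonneg_left (hp.trans hup) (Real.exp_pos _)
  rcases le_total 0 z with hz | hz
  · rw [abs_of_nonneg hz]
    have hpz := mul_le_of_le_mul_exp_neg hp hup
    have hdrift : i * (a * z) ≤ 2 * δ * (a * z) := by gcongr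
    have hextra : 0 ≤ a ^ 2 / c * i := by positivity
    linarith
  · rw [abs_of_nonpos hz]
    have hpz := mul_le_neg_mul_sq_of_mul_exp_neg_le (by positivity) hz hlow
    have hdrift : δ * (a * -z) ≤ i * (a * -z) :=
      mul_le_mul_of_nonneg_right hδ' (mul_nonneg ha (neg_nonneg.2 hz))
    have hsquare : 3 / 2 * a * -z - c * z ^ 2 ≤ a ^ 2 / c := by
      rw [le_div_iff₀ hc]
      nlinarith [sq_nonneg (c * -z - 3 / 4 * a), sq_nonneg a]
    have := mul_le_mul_of_nonneg_right hsquare hi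
    linarith

theorem exists_eventually_sub_mul_le {p z : ℕ → ℝ} {a : ℝ} (ha : 0 ≤ a) (hp : ∀ t, 0 ≤ p t)
    (hup : p =O[atTop] fun t : ℕ => Real.exp (-z t) / t)
    (hlow : a ≠ 0 → (fun t : ℕ => Real.exp (-z t) / t) =O[atTop] p) :
    ∃ G, ∀ᶠ t : ℕ in atTop, (p t - logStep t * a) * z t ≤ (G - a / 2 * |z t|) / t := by
  obtain ⟨C, hC⟩ := hup.bound
  have hC' : ∀ᶠ t in atTop, p t ≤ C * (1 / t) * Real.exp (-z t) := by
    filter_upwards [hC] with t ht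
    rw [Real.norm_of_nonneg (hp t), Real.norm_of_nonneg (by positivity)] at ht
    exact ht.trans_eq (by ring)
  rcases ha.eq_or_lt with rfl | ha
  · refine ⟨C, ?_⟩
    filter_upwards [hC'] with t ht
    have := mul_le_of_le_mul_exp_neg (hp t) ht
    rw [mul_zero, sub_zero, zero_div, zero_mul, sub_zero, div_eq_mul_one_div]
    exact this
  · obtain ⟨c, hc, hbound⟩ := (hlow ha.ne').exists_pos
    refine ⟨C + a ^ 2 / c⁻¹, ?_⟩
    filter_upwards [hC', hbound.bound, eventually_ge_atTop 1] with t ht hb ht1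
    rw [Real.norm_of_nonneg (hp t), Real.norm_of_nonneg (by positivity)] at hb
    rw [div_eq_mul_one_div _ (t : ℝ)]
    refine sub_mul_le_of_mul_exp_neg_le (inv_pos.2 hc) ha.le (by positivity) ?_ ht
      (one_div_le_two_mul_logStep ht1) (logStep_le_one_div t)
    calc c⁻¹ * (1 / t) * Real.exp (-z t) = c⁻¹ * (Real.exp (-z t) / t) := by ring
      _ ≤ p t := (inv_mul_le_iff₀ hc).2 hb

end Drift

section WeightedSums

variable {ι τ E : Type*} [NormedAddCommGroup E]

theorem norm_sum_smul_sq_le_sum_sq_mul_sum_sq [NormedSpace ℝ E] (s : Finset ι) (c : ι → ℝ)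
    (x : ι → E) : ‖∑ n ∈ s, c n • x n‖ ^ 2 ≤ (∑ n ∈ s, c n ^ 2) * ∑ n ∈ s, ‖x n‖ ^ 2 :=
  calc ‖∑ n ∈ s, c n • x n‖ ^ 2 ≤ (∑ n ∈ s, |c n| * ‖x n‖) ^ 2 := by
        gcongr; exact norm_sum_le_of_le _ fun n _ => (norm_smul _ _).le
    _ ≤ (∑ n ∈ s, |c n| ^ 2) * ∑ n ∈ s, ‖x n‖ ^ 2 := Finset.sum_mul_sq_le_sq_mul_sq _ _ _
    _ = (∑ n ∈ s, c n ^ 2) * ∑ n ∈ s, ‖x n‖ ^ 2 := by simp only [sq_abs]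

theorem summable_norm_sq_sum_smul [NormedSpace ℝ E] (s : Finset ι) (x : ι → E) {y : τ → ι → ℝ}
    (hy : ∀ n, Summable fun t => y t n ^ 2) : Summable fun t => ‖∑ n ∈ s, y t n • x n‖ ^ 2 :=
  Summable.of_nonneg_of_le (fun _ => sq_nonneg _)
    (fun t => norm_sum_smul_sq_le_sum_sq_mul_sum_sq s (y t) x)
    ((summable_sum fun n _ => hy n).mul_right _)

theorem exists_mul_norm_le_sum_inner [InnerProductSpace ℝ E] [Fintype ι] (x : ι → E) {α : ι → ℝ}
    (hα : ∀ n, 0 ≤ α n) : ∃ κ > 0, ∀ s ∈ Submodule.span ℝ (x '' Function.support α),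
      κ * ‖s‖ ≤ ∑ n, α n * |⟪s, x n⟫| := by
  set W := Submodule.span ℝ (x '' Function.support α)
  have : FiniteDimensional ℝ W := FiniteDimensional.span_of_finite ℝ (Set.toFinite _)
  let f : W →ₗ[ℝ] (ι → ℝ) := LinearMap.pi fun n => α n • (innerₛₗ ℝ (x n)).comp W.subtype
  have hf : ∀ s n, f s n = α n * ⟪(s : E), x n⟫ := fun s n => by
    simp [f, real_inner_comm]
  have hker : f.ker = ⊥ := by
    refine LinearMap.ker_eq_bot'.2 fun s hs => ?_
    have hle : W ≤ (innerₛₗ ℝ (s : E)).ker := by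
      refine Submodule.span_le.2 ?_
      rintro _ ⟨n, hn, rfl⟩
      have := congrFun hs n
      rw [hf] at this
      exact (mul_eq_zero.1 this).resolve_left hn
    exact Subtype.ext (inner_self_eq_zero.1 (LinearMap.mem_ker.1 (hle s.2)))
  obtain ⟨K, hK, hanti⟩ := f.exists_antilipschitzWith hker
  have hK' : (0 : ℝ) < K := hK
  refine ⟨(K : ℝ)⁻¹, inv_pos.2 hK', fun s hs => ?_⟩
  have hbound : ‖s‖ ≤ K * ‖f ⟨s, hs⟩‖ := by
    simpa [dist_zero_right] using hanti.le_mul_dist ⟨s, hs⟩ 0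
  have hnonneg : ∀ n, 0 ≤ α n * |⟪s, x n⟫| := fun n => mul_nonneg (hα n) (abs_nonneg _)
  refine (inv_mul_le_iff₀ hK').2 (hbound.trans (mul_le_mul_of_nonneg_left ?_ K.2))
  refine (pi_norm_le_iff_of_nonneg (Finset.sum_nonneg fun n _ => hnonneg n)).2 fun n => ?_
  rw [hf, Real.norm_eq_abs, abs_mul, abs_of_nonneg (hα n)]
  exact Finset.single_le_sum (f := fun n => α n * |⟪s, x n⟫|) (fun n _ => hnonneg n)
    (Finset.mem_univ n)

end WeightedSums

section ExpDriven

variable {ι E : Type*} [Fintype ι] [NormedAddCommGroup E] [InnerProductSpace ℝ E]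
  {x : ι → E} {v : ℕ → E} {p : ℕ → ι → ℝ} {w : E} {α : ι → ℝ}

/-- Sequences `v` moved along the points `x n` by steps `p t n` of order `exp (-⟪v t, x n⟫)`: the
common abstraction of the two sampling regimes (and of gradient descent on an exponential loss). -/
structure IsExpDriven (x : ι → E) (v : ℕ → E) (p : ℕ → ι → ℝ) : Prop where
  step : ∀ t, v (t + 1) = v t + ∑ n, p t n • x n
  nonneg : ∀ t n, 0 ≤ p t n
  isTheta : ∀ n, (fun t => p t n) =Θ[atTop] fun t => Real.exp (-⟪v t, x n⟫)
  summable_sq : ∀ n, Summable fun t => p t n ^ 2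

/-- The deviation of `v t` from its expected asymptotics `log t • w`. -/
noncomputable def residual (v : ℕ → E) (w : E) (t : ℕ) : E := v t - Real.log t • w

/-- The part of the residual accumulated along the points with nonzero weight. -/
noncomputable def supportResidual (x : ι → E) (α : ι → ℝ) (p : ℕ → ι → ℝ) (t : ℕ) : E :=
  ∑ u ∈ Finset.range t, ∑ n with α n ≠ 0, (p u n - logStep u * α n) • x n

theorem supportResidual_succ_sub (x : ι → E) (α : ι → ℝ) (p : ℕ → ι → ℝ) (t : ℕ) :
    supportResidual x α p (t + 1) - supportResidual x α p t =
      ∑ n with α n ≠ 0, (p t n - logStep t * α n) • x n := by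
  simp only [supportResidual, Finset.sum_range_succ, add_sub_cancel_left]

theorem supportResidual_mem_span (x : ι → E) (α : ι → ℝ) (p : ℕ → ι → ℝ) (t : ℕ) :
    supportResidual x α p t ∈ Submodule.span ℝ (x '' Function.support α) :=
  Submodule.sum_mem _ fun _ _ => Submodule.sum_mem _ fun n hn =>
    Submodule.smul_mem _ _ (Submodule.subset_span ⟨n, (Finset.mem_filter.1 hn).2, rfl⟩)

theorem isTheta_exp_neg_inner {r s : ℕ → E} {F : ℝ} (hrs : ∀ t, ‖r t - s t‖ ≤ F) (z : E) :
    (fun t => Real.exp (-⟪r t, z⟫)) =Θ[atTop] fun t => Real.exp (-⟪s t, z⟫) := by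
  refine Real.isTheta_exp_comp_exp_comp.2 (isBoundedUnder_of ⟨F * ‖z‖, fun t => ?_⟩)
  calc |-⟪r t, z⟫ - -⟪s t, z⟫| = |⟪r t - s t, z⟫| := by rw [inner_sub_left, ← abs_neg]; ring_nf
    _ ≤ ‖r t - s t‖ * ‖z‖ := abs_real_inner_le_norm _ _
    _ ≤ F * ‖z‖ := by gcongr; exact hrs t

namespace IsExpDriven

theorem residual_succ_sub (h : IsExpDriven x v p) (hw : w = ∑ n, α n • x n) (t : ℕ) :
    residual v w (t + 1) - residual v w t = ∑ n, (p t n - logStep t * α n) • x n := by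
  have hsum : ∑ n, (p t n - logStep t * α n) • x n = ∑ n, p t n • x n - logStep t • w := by
    simp only [sub_smul, mul_smul, Finset.sum_sub_distrib, ← Finset.smul_sum, ← hw]
  rw [hsum, residual, residual, h.step, logStep, sub_smul]
  abel

theorem isTheta_residual (h : IsExpDriven x v p) (w : E) (n : ι) :
    (fun t => p t n) =Θ[atTop]
      fun t : ℕ => Real.exp (-⟪residual v w t, x n⟫) * (t : ℝ) ^ (-⟪w, x n⟫) := by
  refine (h.isTheta n).trans_eventuallyEq ?_
  filter_upwards [eventually_ge_atTop 1] with t ht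
  rw [Real.rpow_def_of_pos (by positivity), ← Real.exp_add, residual, inner_sub_left,
    real_inner_smul_left]
  ring_nf

theorem isTheta_residual_of_inner_eq_one (h : IsExpDriven x v p) {n : ι} (hn : ⟪w, x n⟫ = 1) :
    (fun t => p t n) =Θ[atTop] fun t : ℕ => Real.exp (-⟪residual v w t, x n⟫) / t := by
  simpa only [hn, Real.rpow_neg_one, ← div_eq_mul_inv] using h.isTheta_residual w n

theorem isBigO_residual_of_one_le_inner (h : IsExpDriven x v p) {n : ι} (hn : 1 ≤ ⟪w, x n⟫) :
    (fun t => p t n) =O[atTop] fun t : ℕ => Real.exp (-⟪residual v w t, x n⟫) / t := by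
  refine (h.isTheta_residual w n).isBigO.trans (IsBigO.of_norm_eventuallyLE ?_)
  filter_upwards [eventually_ge_atTop 1] with t ht
  rw [Real.norm_of_nonneg (by positivity), div_eq_mul_inv, ← Real.rpow_neg_one]
  gcongr
  exact_mod_cast ht

theorem summable_sub_logStep_sq (h : IsExpDriven x v p) (α : ι → ℝ) (n : ι) :
    Summable fun t => (p t n - logStep t * α n) ^ 2 :=
  summable_sub_mul_sq (h.summable_sq n) summable_sq_logStep _

theorem residual_isLittleO_log (h : IsExpDriven x v p) (hα : IsKKTPair x w α) :
    residual v w =o[atTop] fun t : ℕ => Real.log t := by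
  have hdrift : ∀ n, ∃ G, ∀ᶠ t : ℕ in atTop,
      (p t n - logStep t * α n) * ⟪residual v w t, x n⟫ ≤
        (G - α n / 2 * |⟪residual v w t, x n⟫|) / t := fun n =>
    exists_eventually_sub_mul_le (hα.nonneg n) (fun t => h.nonneg t n)
      (h.isBigO_residual_of_one_le_inner (hα.feasible n)) fun hn =>
        (h.isTheta_residual_of_inner_eq_one ((hα.slack n).resolve_left hn)).symm.isBigO
  choose G hG using hdrift
  refine isLittleO_log_of_inner_step_le (G := ∑ n, G n) ?_ ?_
  · simp only [h.residual_succ_sub hα.stationary]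
    exact summable_norm_sq_sum_smul _ x (h.summable_sub_logStep_sq α)
  · filter_upwards [eventually_all.2 hG] with t ht
    rw [h.residual_succ_sub hα.stationary, inner_sum, Finset.sum_div]
    refine Finset.sum_le_sum fun n _ => ?_
    rw [real_inner_smul_right]
    refine (ht n).trans ?_
    gcongr
    exact sub_le_self _ (mul_nonneg (div_nonneg (hα.nonneg n) zero_le_two) (abs_nonneg _))

theorem summable_of_one_lt_inner (h : IsExpDriven x v p) (hα : IsKKTPair x w α) {n : ι}
    (hn : 1 < ⟪w, x n⟫) : Summable fun t => p t n := by
  set θ := ⟪w, x n⟫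
  have hinner : (fun t => ⟪residual v w t, x n⟫) =o[atTop] fun t : ℕ => Real.log t :=
    (IsBigO.of_bound ‖x n‖ (Eventually.of_forall fun t => by
      rw [mul_comm]; exact norm_inner_le_norm _ _)).trans_isLittleO (h.residual_isLittleO_log hα)
  have hsummable : Summable fun t : ℕ => (t : ℝ) ^ (-((1 + θ) / 2)) :=
    Real.summable_nat_rpow.2 (by linarith)
  refine summable_of_isBigO_nat hsummable
    ((h.isTheta_residual w n).isBigO.trans (IsBigO.of_norm_eventuallyLE ?_))
  filter_upwards [hinner.bound (half_pos (sub_pos.2 hn)), eventually_ge_atTop 1] with t hbound ht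
  have hlog : 0 ≤ Real.log t := Real.log_nonneg (by exact_mod_cast ht)
  rw [Real.norm_of_nonneg hlog] at hbound
  have hlower := neg_le_of_abs_le hbound
  rw [Real.norm_of_nonneg (by positivity), Real.rpow_def_of_pos (by positivity),
    Real.rpow_def_of_pos (by positivity), ← Real.exp_add]
  exact Real.exp_le_exp.2 (by linarith)

theorem residual_sub_supportResidual_succ_sub (h : IsExpDriven x v p)
    (hw : w = ∑ n, α n • x n) (t : ℕ) :
    (residual v w (t + 1) - supportResidual x α p (t + 1)) -
      (residual v w t - supportResidual x α p t) = ∑ n with α n = 0, p t n • x n := by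
  rw [sub_sub_sub_comm, h.residual_succ_sub hw, supportResidual_succ_sub, sub_eq_iff_eq_add,
    ← Finset.sum_filter_add_sum_filter_not Finset.univ fun n => α n = 0]
  congr 1
  exact Finset.sum_congr rfl fun n hn => by simp [(Finset.mem_filter.1 hn).2]

theorem exists_norm_residual_sub_supportResidual_le (h : IsExpDriven x v p)
    (hα : IsStrictKKTPair x w α) :
    ∃ F, ∀ t, ‖residual v w t - supportResidual x α p t‖ ≤ F := by
  have hsum : Summable fun t => ‖∑ n with α n = 0, p t n • x n‖ := by
    refine Summable.of_nonneg_of_le (fun _ => norm_nonneg _) (fun t => norm_sum_le _ _)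
      (summable_sum fun n hn => ?_)
    simp only [norm_smul]
    exact (h.summable_of_one_lt_inner hα.toIsKKTPair
      (hα.strict n (Finset.mem_filter.1 hn).2)).norm.mul_right _
  have hcauchy : CauchySeq fun t => residual v w t - supportResidual x α p t := by
    refine cauchySeq_of_summable_dist ?_
    simpa only [dist_eq_norm', Nat.succ_eq_add_one,
      h.residual_sub_supportResidual_succ_sub hα.stationary] using hsum
  obtain ⟨F, hF⟩ := hcauchy.isBounded_range.exists_norm_le
  exact ⟨F, fun t => hF _ ⟨t, rfl⟩⟩

theorem exists_norm_supportResidual_le (h : IsExpDriven x v p) (hα : IsStrictKKTPair x w α) :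
    ∃ R, ∀ t, ‖supportResidual x α p t‖ ≤ R := by
  obtain ⟨F, hF⟩ := h.exists_norm_residual_sub_supportResidual_le hα
  obtain ⟨κ, hκ, hspan⟩ := exists_mul_norm_le_sum_inner x hα.nonneg
  have hdrift : ∀ n, ∃ G, α n ≠ 0 → ∀ᶠ t : ℕ in atTop,
      (p t n - logStep t * α n) * ⟪supportResidual x α p t, x n⟫ ≤
        (G - α n / 2 * |⟪supportResidual x α p t, x n⟫|) / t := by
    intro n
    by_cases hn : α n = 0
    · exact ⟨0, fun hne => absurd hn hne⟩
    have hp := (h.isTheta_residual_of_inner_eq_one ((hα.slack n).resolve_left hn)).trans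
      ((isTheta_exp_neg_inner hF (x n)).div (isTheta_refl _ _))
    obtain ⟨G, hG⟩ := exists_eventually_sub_mul_le (hα.nonneg n) (fun t => h.nonneg t n)
      hp.isBigO fun _ => hp.symm.isBigO
    exact ⟨G, fun _ => hG⟩
  choose G hG using hdrift
  refine exists_norm_le_of_inner_step_le (G := ∑ n with α n ≠ 0, G n) (half_pos hκ) ?_ ?_
  · simp only [supportResidual_succ_sub]
    exact summable_norm_sq_sum_smul _ x (h.summable_sub_logStep_sq α)
  filter_upwards [eventually_all.2 fun n => eventually_imp_distrib_left.2 (hG n)] with t ht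
  set s := supportResidual x α p t
  have hsupport : ∑ n with α n ≠ 0, α n / 2 * |⟪s, x n⟫| = (∑ n, α n * |⟪s, x n⟫|) / 2 := by
    simp only [Finset.sum_div, div_mul_eq_mul_div]
    exact Finset.sum_filter_of_ne fun n _ hne hn => hne (by rw [hn, zero_mul, zero_div])
  calc ⟪s, supportResidual x α p (t + 1) - s⟫
      = ∑ n with α n ≠ 0, (p t n - logStep t * α n) * ⟪s, x n⟫ := by
        simp only [s, supportResidual_succ_sub, inner_sum, real_inner_smul_right]
    _ ≤ ∑ n with α n ≠ 0, (G n - α n / 2 * |⟪s, x n⟫|) / t :=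
        Finset.sum_le_sum fun n hn => ht n (Finset.mem_filter.1 hn).2
    _ = (∑ n with α n ≠ 0, G n - (∑ n, α n * |⟪s, x n⟫|) / 2) / t := by
        rw [← Finset.sum_div, Finset.sum_sub_distrib, hsupport]
    _ ≤ (∑ n with α n ≠ 0, G n - κ / 2 * ‖s‖) / t := by
        gcongr
        linarith [hspan s (supportResidual_mem_span x α p t)]

theorem exists_norm_residual_le (h : IsExpDriven x v p) (hα : IsStrictKKTPair x w α) :
    ∃ R, ∀ t, ‖residual v w t‖ ≤ R := by
  obtain ⟨F, hF⟩ := h.exists_norm_residual_sub_supportResidual_le hα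
  obtain ⟨R, hR⟩ := h.exists_norm_supportResidual_le hα
  exact ⟨F + R, fun t => (norm_le_norm_sub_add _ _).trans (add_le_add (hF t) (hR t))⟩

end IsExpDriven

end ExpDriven

section Smoothness

variable {f : ℝ → ℝ} {β : ℝ≥0}

theorem le_add_deriv_mul_add_sq_of_lipschitzWith_deriv (hf : Differentiable ℝ f)
    (hf' : LipschitzWith β (deriv f)) (u h : ℝ) :
    f (u + h) ≤ f u + deriv f u * h + β / 2 * h ^ 2 := by
  let g : ℝ → ℝ := fun s => f (u + s * h) - f u - s * (deriv f u * h)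
  have hg : ∀ s, HasDerivAt g ((deriv f (u + s * h) - deriv f u) * h) s := fun s => by
    have hline : HasDerivAt (fun s => u + s * h) h s := by
      simpa using ((hasDerivAt_id s).mul_const h).const_add u
    have hcomp := (((hf _).hasDerivAt.comp s hline).sub_const (f u)).sub
      ((hasDerivAt_id s).mul_const (deriv f u * h))
    exact HasDerivAt.congr_deriv (f := g) hcomp (by ring)
  have hB : ∀ s, HasDerivAt (fun s => β / 2 * h ^ 2 * s ^ 2) (β * h ^ 2 * s) s := fun s =>
    ((hasDerivAt_pow 2 s).const_mul _).congr_deriv (by push_cast; ring)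
  have hbound : ∀ s ∈ Set.Ico (0 : ℝ) 1,
      ‖(deriv f (u + s * h) - deriv f u) * h‖ ≤ β * h ^ 2 * s := fun s hs => by
    have hlip := hf'.norm_sub_le (u + s * h) u
    rw [add_sub_cancel_left, norm_mul, Real.norm_of_nonneg hs.1] at hlip
    calc ‖(deriv f (u + s * h) - deriv f u) * h‖ ≤ β * (s * ‖h‖) * ‖h‖ := by
          rw [norm_mul]; gcongr
      _ = β * h ^ 2 * s := by rw [← sq_abs h, Real.norm_eq_abs]; ring
  have hfence := image_norm_le_of_norm_deriv_right_le_deriv_boundary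
    (fun s _ => (hg s).continuousAt.continuousWithinAt) (fun s _ => (hg s).hasDerivWithinAt)
    (by simp [g]) hB hbound (Set.right_mem_Icc.2 zero_le_one)
  have := (le_abs_self _).trans hfence
  simp only [g, one_mul, one_pow, mul_one] at this
  linarith

theorem isBigO_exp_neg_of_deriv (hf : Differentiable ℝ f) (hlim : Tendsto f atTop (𝓝 0))
    (hf' : deriv f =O[atTop] fun u => Real.exp (-u)) : f =O[atTop] fun u => Real.exp (-u) := by
  obtain ⟨C, hC, hbound⟩ := hf'.exists_nonneg
  obtain ⟨U, hU⟩ := eventually_atTop.1 hbound.bound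
  simp only [Real.norm_of_nonneg (Real.exp_pos _).le] at hU
  refine IsBigO.of_bound C ?_
  filter_upwards [eventually_ge_atTop U] with u hu
  have hB : ∀ s, HasDerivAt (fun s => C * (Real.exp (-u) - Real.exp (-s)))
      (C * Real.exp (-s)) s := fun s =>
    (((hasDerivAt_neg s).exp.const_sub (Real.exp (-u))).const_mul C).congr_deriv (by ring)
  have hincr : ∀ s ≥ u, ‖f s - f u‖ ≤ C * Real.exp (-u) := fun s hs =>
    calc ‖f s - f u‖ ≤ C * (Real.exp (-u) - Real.exp (-s)) :=
          image_norm_le_of_norm_deriv_right_le_deriv_boundary (f' := deriv f)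
            (hf.continuous.sub continuous_const).continuousOn
            (fun r _ => ((hf r).hasDerivAt.sub_const _).hasDerivWithinAt) (by simp) hB
            (fun r hr => hU r (hu.trans hr.1)) (Set.right_mem_Icc.2 hs)
      _ ≤ C * Real.exp (-u) := by
          gcongr; exact sub_le_self _ (Real.exp_pos _).le
  have hto : Tendsto (fun s => ‖f s - f u‖) atTop (𝓝 ‖f u‖) := by
    simpa using (hlim.sub_const (f u)).norm
  rw [Real.norm_of_nonneg (Real.exp_pos _).le]
  exact le_of_tendsto hto ((eventually_ge_atTop u).mono hincr)

theorem HasTightExponentialTail.isTheta (hf : HasTightExponentialTail f) :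
    f =Θ[atTop] fun u => Real.exp (-u) := by
  obtain ⟨μp, hμp, μm, hμm, U, hU, htail⟩ := hf
  have hlarge : ∀ᶠ u : ℝ in atTop, 0 < u ∧ (1 / 2) * Real.exp (-u) ≤ f u ∧
      f u ≤ 2 * Real.exp (-u) := by
    filter_upwards [eventually_gt_atTop U, eventually_ge_atTop (1 / μm)] with u hu hμu
    have hu0 := hU.trans hu
    obtain ⟨hlow, hup⟩ := htail u hu
    have hexp_p : Real.exp (-μp * u) ≤ 1 := Real.exp_le_one_iff.2 (by nlinarith)
    have hexp_m : Real.exp (-μm * u) ≤ 1 / 2 := by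
      have : 2 ≤ Real.exp (μm * u) := by
        linarith [Real.add_one_le_exp (μm * u), (div_le_iff₀' hμm).1 hμu]
      rw [neg_mul, Real.exp_neg, one_div]
      exact inv_anti₀ two_pos this
    refine ⟨hu0, le_trans ?_ hlow, hup.trans ?_⟩ <;> gcongr <;> linarith
  refine ⟨IsBigO.of_bound 2 ?_, IsBigO.of_bound 2 ?_⟩ <;>
    filter_upwards [hlarge] with u ⟨_, hlow, hup⟩ <;>
    rw [Real.norm_of_nonneg (Real.exp_pos _).le,
      Real.norm_of_nonneg (le_trans (by positivity) hlow)]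
  · exact hup
  · linarith

end Smoothness

section Loss

variable {N d : ℕ} {ℓ : ℝ → ℝ} {β : ℝ≥0}

/-- The sum of the squared derivatives of the losses at the data points: by the margin and
singular value bounds it is comparable with the squared norm of the gradient of the training
loss. -/
noncomputable def derivSq (ℓ : ℝ → ℝ) (x : Dataset N d) (w : Vec d) : ℝ :=
  ∑ n, deriv ℓ ⟪w, x n⟫ ^ 2

/-- The negative gradient of the training loss. -/
noncomputable def negGrad (ℓ : ℝ → ℝ) (x : Dataset N d) (w : Vec d) : Vec d :=
  ∑ n, (-deriv ℓ ⟪w, x n⟫) • x n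

theorem derivSq_nonneg (ℓ : ℝ → ℝ) (x : Dataset N d) (w : Vec d) : 0 ≤ derivSq ℓ x w :=
  Finset.sum_nonneg fun _ _ => sq_nonneg _

theorem sq_deriv_le_derivSq (ℓ : ℝ → ℝ) (x : Dataset N d) (w : Vec d) (n : Fin N) :
    deriv ℓ ⟪w, x n⟫ ^ 2 ≤ derivSq ℓ x w :=
  Finset.single_le_sum (f := fun n => deriv ℓ ⟪w, x n⟫ ^ 2) (fun _ _ => sq_nonneg _)
    (Finset.mem_univ n)

theorem sgd_succ (ℓ : ℝ → ℝ) (x : Dataset N d) (η : ℝ) (B : ℕ) (batch : ℕ → Finset (Fin N))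
    (w₀ : Vec d) (t : ℕ) :
    sgd ℓ x η B batch w₀ (t + 1) = sgd ℓ x η B batch w₀ t +
      (η / B) • ∑ n ∈ batch t, (-deriv ℓ ⟪sgd ℓ x η B batch w₀ t, x n⟫) • x n := by
  rw [sgd]
  simp only [neg_smul, Finset.sum_neg_distrib, smul_neg, sub_eq_add_neg]

namespace IsSmoothMonotoneLoss

theorem beta_pos (h : IsSmoothMonotoneLoss ℓ β) : 0 < (β : ℝ) := by
  refine NNReal.coe_pos.2 (pos_iff_ne_zero.2 ?_)
  rintro rfl
  have hconst : ∀ u, deriv ℓ 0 = deriv ℓ u := fun u => by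
    simpa using h.lipschitz_deriv 0 u
  exact (h.deriv_neg 0).ne
    (tendsto_nhds_unique (tendsto_const_nhds.congr hconst) h.tendsto_deriv_zero)

theorem exists_le_neg_deriv (h : IsSmoothMonotoneLoss ℓ β) (M : ℝ) :
    ∃ c > 0, ∀ u ≤ M, c ≤ -deriv ℓ u := by
  have hlimsup : limsup (fun u => ((deriv ℓ u : ℝ) : EReal)) atBot < 0 := by
    refine lt_of_le_of_ne (limsup_le_of_le (by isBoundedDefault) ?_) h.limsup_deriv_ne_zero
    exact Eventually.of_forall fun u => by exact_mod_cast (h.deriv_neg u).le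
  obtain ⟨b, hlt, hb⟩ := EReal.lt_iff_exists_real_btwn.1 hlimsup
  obtain ⟨A, hA⟩ := eventually_atBot.1 (eventually_lt_of_limsup_lt hlt)
  obtain ⟨m, -, hmax⟩ := (isCompact_Icc (a := min A M) (b := M)).exists_isMaxOn
    ⟨M, min_le_right _ _, le_rfl⟩ h.lipschitz_deriv.continuous.continuousOn
  refine ⟨min (-b) (-deriv ℓ m),
    lt_min (neg_pos.2 (EReal.coe_neg'.1 hb)) (neg_pos.2 (h.deriv_neg m)), fun u hu => ?_⟩
  rcases le_total u (min A M) with huA | huA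
  · exact (min_le_left _ _).trans
      (neg_le_neg (EReal.coe_lt_coe_iff.1 (hA u (huA.trans (min_le_left _ _)))).le)
  · exact (min_le_right _ _).trans (neg_le_neg (hmax ⟨huA, hu⟩))

theorem tendsto_atTop_of_summable_sq (h : IsSmoothMonotoneLoss ℓ β) {u : ℕ → ℝ}
    (hu : Summable fun t => deriv ℓ (u t) ^ 2) : Tendsto u atTop atTop := by
  refine tendsto_atTop.2 fun M => ?_
  obtain ⟨c, hc, hcM⟩ := h.exists_le_neg_deriv M
  filter_upwards [hu.tendsto_atTop_zero.eventually_lt_const (pow_pos hc 2)] with t ht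
  by_contra! hlt
  have := pow_le_pow_left₀ hc.le (hcM _ hlt.le) 2
  rw [neg_sq] at this
  exact this.not_gt ht

theorem trainingLoss_nonneg (h : IsSmoothMonotoneLoss ℓ β) (x : Dataset N d) (w : Vec d) :
    0 ≤ trainingLoss ℓ x w :=
  Finset.sum_nonneg fun _ _ => (h.pos _).le

theorem trainingLoss_add_le (h : IsSmoothMonotoneLoss ℓ β) (x : Dataset N d) (w Δ : Vec d) :
    trainingLoss ℓ x (w + Δ) ≤
      trainingLoss ℓ x w - ⟪Δ, negGrad ℓ x w⟫ + β / 2 * sigmaMax x ^ 2 * ‖Δ‖ ^ 2 :=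
  calc trainingLoss ℓ x (w + Δ)
      ≤ ∑ n, (ℓ ⟪w, x n⟫ + deriv ℓ ⟪w, x n⟫ * ⟪Δ, x n⟫ + β / 2 * ⟪Δ, x n⟫ ^ 2) := by
        refine Finset.sum_le_sum fun n _ => ?_
        rw [inner_add_left]
        exact le_add_deriv_mul_add_sq_of_lipschitzWith_deriv h.differentiable h.lipschitz_deriv _ _
    _ = trainingLoss ℓ x w - ⟪Δ, negGrad ℓ x w⟫ + β / 2 * ∑ n, ⟪Δ, x n⟫ ^ 2 := by
        simp only [Finset.sum_add_distrib, inner_sum, inner_smul_right, Finset.mul_sum,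
          trainingLoss, negGrad, neg_mul, Finset.sum_neg_distrib, sub_neg_eq_add]
    _ ≤ trainingLoss ℓ x w - ⟪Δ, negGrad ℓ x w⟫ + β / 2 * sigmaMax x ^ 2 * ‖Δ‖ ^ 2 := by
        rw [mul_assoc]
        gcongr
        exact sum_inner_sq_le x Δ

theorem maxMargin_sq_mul_derivSq_le (h : IsSmoothMonotoneLoss ℓ β) {x : Dataset N d}
    (hγ : 0 ≤ maxMargin x) (w : Vec d) :
    maxMargin x ^ 2 * derivSq ℓ x w ≤ ‖negGrad ℓ x w‖ ^ 2 := by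
  simpa only [neg_sq, derivSq, negGrad] using
    maxMargin_sq_mul_sum_sq_le hγ (c := fun n => -deriv ℓ ⟪w, x n⟫) fun n =>
      neg_nonneg.2 (h.deriv_neg _).le

end IsSmoothMonotoneLoss

end Loss

section Convergence

variable {τ E : Type*} [NormedAddCommGroup E] [NormedSpace ℝ E] {l : Filter τ} {L : τ → ℝ}
  {v : τ → E} {w : E}

theorem norm_normalize_sub_le (a : E) {b : E} (hb : b ≠ 0) :
    ‖‖a‖⁻¹ • a - ‖b‖⁻¹ • b‖ ≤ 2 * ‖a - b‖ / ‖b‖ := by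
  have hb' : 0 < ‖b‖ := norm_pos_iff.2 hb
  have hunit : ‖‖a‖⁻¹ • a‖ ≤ 1 := by
    rw [norm_smul, norm_inv, norm_norm]; exact inv_mul_le_one
  have hsplit : ‖b‖ • (‖a‖⁻¹ • a - ‖b‖⁻¹ • b) = (‖b‖ - ‖a‖) • ‖a‖⁻¹ • a + (a - b) := by
    have ha : ‖a‖ • ‖a‖⁻¹ • a = a := by
      rcases eq_or_ne a 0 with rfl | ha
      · simp
      · exact smul_inv_smul₀ (norm_ne_zero_iff.2 ha) a
    rw [smul_sub, sub_smul, smul_inv_smul₀ hb'.ne', ha]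
    abel
  rw [le_div_iff₀ hb', mul_comm]
  calc ‖b‖ * ‖‖a‖⁻¹ • a - ‖b‖⁻¹ • b‖ = ‖(‖b‖ - ‖a‖) • ‖a‖⁻¹ • a + (a - b)‖ := by
        rw [← hsplit, norm_smul, norm_norm]
    _ ≤ |‖b‖ - ‖a‖| * ‖‖a‖⁻¹ • a‖ + ‖a - b‖ := by
        rw [← Real.norm_eq_abs, ← norm_smul]; exact norm_add_le _ _
    _ ≤ ‖a - b‖ * 1 + ‖a - b‖ := by
        gcongr
        rw [norm_sub_rev]
        exact abs_norm_sub_norm_le b a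
    _ = 2 * ‖a - b‖ := by ring

theorem isBigO_normalize_sub (hL : Tendsto L l atTop) (hw : w ≠ 0)
    (hv : (fun t => v t - L t • w) =O[l] fun _ => (1 : ℝ)) :
    (fun t => ‖v t‖⁻¹ • v t - ‖w‖⁻¹ • w) =O[l] fun t => 1 / L t := by
  obtain ⟨C, hC⟩ := hv.bound
  refine IsBigO.of_bound (2 * C / ‖w‖) ?_
  filter_upwards [hC, hL.eventually_gt_atTop 0] with t hCt hLt
  have hscale : ‖L t • w‖⁻¹ • L t • w = ‖w‖⁻¹ • w := by
    rw [norm_smul, Real.norm_of_nonneg hLt.le, mul_inv, mul_smul, smul_comm, inv_smul_smul₀ hLt.ne']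
  rw [norm_one, mul_one] at hCt
  calc ‖‖v t‖⁻¹ • v t - ‖w‖⁻¹ • w‖ ≤ 2 * ‖v t - L t • w‖ / ‖L t • w‖ := by
        rw [← hscale]; exact norm_normalize_sub_le _ (smul_ne_zero hLt.ne' hw)
    _ ≤ 2 * C / ‖L t • w‖ := by gcongr
    _ = 2 * C / ‖w‖ * ‖1 / L t‖ := by
        rw [norm_smul, norm_div, norm_one]; field_simp

variable {N d : ℕ} {x : Dataset N d} {ℓ : ℝ → ℝ} {β : ℝ≥0} {what : Vec d} {u : ℕ → Vec d} {R : ℝ}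

theorem MarginFeasible.ne_zero (hwhat : MarginFeasible x what) (hN : 0 < N) : what ≠ 0 := by
  rintro rfl
  have := hwhat ⟨0, hN⟩
  rw [inner_zero_left] at this
  linarith

theorem MarginFeasible.log_sub_le_inner (hwhat : MarginFeasible x what)
    (hR : ∀ t, ‖residual u what t‖ ≤ R) (n : Fin N) (t : ℕ) :
    Real.log t - R * ‖x n‖ ≤ ⟪u t, x n⟫ := by
  have hres : -(R * ‖x n‖) ≤ ⟪residual u what t, x n⟫ := by
    refine neg_le_of_abs_le ((abs_real_inner_le_norm _ _).trans ?_)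
    gcongr
    exact hR t
  have hlog : Real.log t ≤ Real.log t * ⟪what, x n⟫ :=
    le_mul_of_one_le_right (Real.log_natCast_nonneg t) (hwhat n)
  rw [residual, inner_sub_left, real_inner_smul_left] at hres
  linarith

theorem IsSmoothMonotoneLoss.isBigO_trainingLoss (h : IsSmoothMonotoneLoss ℓ β)
    (htail : deriv ℓ =O[atTop] fun u => Real.exp (-u)) (hwhat : MarginFeasible x what)
    (hR : ∀ t, ‖residual u what t‖ ≤ R) :
    (fun t => trainingLoss ℓ x (u t)) =O[atTop] fun t : ℕ => 1 / (t : ℝ) := by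
  have hℓ := isBigO_exp_neg_of_deriv h.differentiable h.tendsto_zero htail
  simp only [trainingLoss]
  refine IsBigO.fun_sum fun n _ => ?_
  have hinner : Tendsto (fun t => ⟪u t, x n⟫) atTop atTop :=
    tendsto_atTop_mono (hwhat.log_sub_le_inner hR n)
      (tendsto_atTop_add_const_right _ _ tendsto_log_natCast_atTop)
  have hexp : (fun t => Real.exp (-⟪u t, x n⟫)) =O[atTop] fun t : ℕ => Real.exp (-Real.log t) :=
    Real.isBigO_exp_comp_exp_comp.2 (isBoundedUnder_of ⟨R * ‖x n‖, fun t => by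
      simp only [Pi.sub_apply]; linarith [hwhat.log_sub_le_inner hR n t]⟩)
  refine ((hℓ.comp_tendsto hinner).trans hexp).trans_eventuallyEq ?_
  filter_upwards [eventually_gt_atTop 0] with t ht
  rw [Real.exp_neg, Real.exp_log (Nat.cast_pos.2 ht), one_div]

theorem exists_expansion_of_norm_residual_le (hR : ∀ t, ‖residual u what t‖ ≤ R) {a : ℝ}
    (ha : 0 < a) : ∃ ρ : ℕ → Vec d, (∃ C : ℝ, ∀ t, ‖ρ t‖ ≤ C) ∧
      ∀ t : ℕ, 1 ≤ t → u t = Real.log (a * t) • what + ρ t := by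
  refine ⟨fun t => residual u what t - Real.log a • what, ⟨R + ‖Real.log a • what‖, fun t =>
    (norm_sub_le _ _).trans (by gcongr; exact hR t)⟩, fun t ht => ?_⟩
  simp only [Real.log_mul ha.ne' (by positivity : (t : ℝ) ≠ 0), add_smul, residual]
  abel

theorem IsSmoothMonotoneLoss.convergesToSVM (h : IsSmoothMonotoneLoss ℓ β)
    (htail : deriv ℓ =O[atTop] fun u => Real.exp (-u)) (hwhat : MarginFeasible x what)
    (hN : 0 < N) {η : ℝ} (hη : 0 < η) {B K : ℕ} (hB : 0 < B) (hK : 0 < K)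
    (hR : ∀ t, ‖residual u what t‖ ≤ R) : ConvergesToSVM ℓ x what η B K u := by
  have hlog := tendsto_log_natCast_atTop
  have hrate : (fun t => ‖u t‖⁻¹ • u t - ‖what‖⁻¹ • what) =O[atTop]
      fun t : ℕ => 1 / Real.log t :=
    isBigO_normalize_sub hlog (hwhat.ne_zero hN)
      (IsBigO.of_bound R (Eventually.of_forall fun t => by
        rw [norm_one, mul_one]; exact hR t))
  have hlim : Tendsto (fun t : ℕ => 1 / Real.log t) atTop (𝓝 0) :=
    hlog.const_div_atTop 1
  have ha : 0 < η / B / K := by positivity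
  refine ⟨?_, tendsto_sub_nhds_zero_iff.1 (hrate.trans_tendsto hlim), hrate,
    h.isBigO_trainingLoss htail hwhat hR⟩
  simpa only [div_mul_eq_mul_div, ← mul_div_assoc] using exists_expansion_of_norm_residual_le hR ha

end Convergence

theorem IsSmoothMonotoneLoss.isTheta_neg_deriv_inner {N d : ℕ} {x : Dataset N d} {ℓ : ℝ → ℝ}
    {β : ℝ≥0} (h : IsSmoothMonotoneLoss ℓ β)
    (htail : (fun u => -deriv ℓ u) =Θ[atTop] fun u => Real.exp (-u)) {r s : ℕ → Vec d} {F : ℝ}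
    (hrs : ∀ t, ‖r t - s t‖ ≤ F) {n : Fin N}
    (hr : Summable fun t => deriv ℓ ⟪r t, x n⟫ ^ 2) :
    (fun t => -deriv ℓ ⟪r t, x n⟫) =Θ[atTop] fun t => Real.exp (-⟪s t, x n⟫) := by
  have hinner := h.tendsto_atTop_of_summable_sq hr
  exact IsTheta.trans ⟨htail.1.comp_tendsto hinner, htail.2.comp_tendsto hinner⟩
    (isTheta_exp_neg_inner hrs (x n))

section Epochs

theorem exists_forall_mem_iff_eq_of_biUnion_eq_univ {ι : Type*} [Fintype ι] [DecidableEq ι]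
    {B K : ℕ} (hι : Fintype.card ι = K * B) {b : ℕ → Finset ι} (hcard : ∀ k < K, (b k).card = B)
    (hcover : (Finset.range K).biUnion b = Finset.univ) :
    ∃ m : ι → ℕ, (∀ n, m n < K) ∧ ∀ k < K, ∀ n, n ∈ b k ↔ m n = k := by
  have hone : ∀ n, 1 ≤ ((Finset.range K).filter (n ∈ b ·)).card := fun n => by
    obtain ⟨k, hk, hn⟩ := Finset.mem_biUnion.1 (hcover ▸ Finset.mem_univ n)
    exact Finset.card_pos.2 ⟨k, Finset.mem_filter.2 ⟨hk, hn⟩⟩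
  have htotal : ∑ n, ((Finset.range K).filter (n ∈ b ·)).card = ∑ _n : ι, 1 := by
    calc ∑ n, ((Finset.range K).filter (n ∈ b ·)).card = ∑ k ∈ Finset.range K, (b k).card := by
          simp only [Finset.card_filter]
          rw [Finset.sum_comm]
          simp
      _ = ∑ _n : ι, 1 := by
          rw [Finset.sum_congr rfl fun k hk => hcard k (Finset.mem_range.1 hk)]
          simp [hι]
  have hunique : ∀ n, ∃ m, (Finset.range K).filter (n ∈ b ·) = {m} := fun n =>
    Finset.card_eq_one.1 ((Finset.sum_eq_sum_iff_of_le fun n _ => hone n).1 htotal.symm n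
      (Finset.mem_univ n)).symm
  choose m hm using hunique
  have hmem : ∀ n k, (k < K ∧ n ∈ b k) ↔ m n = k := fun n k => by
    simpa [eq_comm] using Finset.ext_iff.1 (hm n) k
  exact ⟨m, fun n => ((hmem n _).2 rfl).1, fun k hk n => by simpa [hk] using hmem n k⟩

variable {N d : ℕ} {x : Dataset N d} {ℓ : ℝ → ℝ} {β : ℝ≥0} {a : ℝ} {K : ℕ} {w : ℕ → Vec d}
  {m : Fin N → ℕ}

/-- A pass of `K` minibatch steps over the data, in which the point `x n` is used exactly once, at
step `m n`. The step size `a` is the one already divided by the size of the minibatches. -/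
structure IsEpoch (ℓ : ℝ → ℝ) (x : Dataset N d) (a : ℝ) (K : ℕ) (w : ℕ → Vec d)
    (m : Fin N → ℕ) : Prop where
  visit_lt : ∀ n, m n < K
  step : ∀ k < K, w (k + 1) = w k + a • ∑ n with m n = k, (-deriv ℓ ⟪w k, x n⟫) • x n

/-- The weight with which the point `x n` enters the steps of an epoch. -/
noncomputable def visitWeight (ℓ : ℝ → ℝ) (x : Dataset N d) (w : ℕ → Vec d) (m : Fin N → ℕ)
    (n : Fin N) : ℝ :=
  -deriv ℓ ⟪w (m n), x n⟫

namespace IsEpoch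

theorem eq_add_smul_sum (hw : IsEpoch ℓ x a K w m) {k : ℕ} (hk : k ≤ K) :
    w k = w 0 + a • ∑ n with m n < k, visitWeight ℓ x w m n • x n := by
  induction k with
  | zero => simp
  | succ k ih =>
    have hvisit : ∑ n with m n = k, (-deriv ℓ ⟪w k, x n⟫) • x n =
        ∑ n with m n = k, visitWeight ℓ x w m n • x n :=
      Finset.sum_congr rfl fun n hn => by rw [visitWeight, (Finset.mem_filter.1 hn).2]
    have hdisj : Disjoint (Finset.univ.filter fun n => m n < k)
        (Finset.univ.filter fun n => m n = k) :=
      Finset.disjoint_filter.2 fun n _ hlt heq => hlt.ne heq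
    simp only [Nat.lt_succ_iff_lt_or_eq, Finset.filter_or]
    rw [hw.step k hk, hvisit, Finset.sum_union hdisj, smul_add, ← add_assoc, ← ih (by omega)]

theorem end_eq (hw : IsEpoch ℓ x a K w m) :
    w K = w 0 + a • ∑ n, visitWeight ℓ x w m n • x n := by
  simpa only [hw.visit_lt, Finset.filter_true] using hw.eq_add_smul_sum le_rfl

theorem norm_sub_sq_le_sum (hw : IsEpoch ℓ x a K w m) {k : ℕ} (hk : k ≤ K) :
    ‖w k - w 0‖ ^ 2 ≤ a ^ 2 * sigmaMax x ^ 2 * ∑ n, visitWeight ℓ x w m n ^ 2 := by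
  have hsum := norm_sum_smul_sq_le x {n | m n < k} (visitWeight ℓ x w m)
  calc ‖w k - w 0‖ ^ 2 = a ^ 2 * ‖∑ n with m n < k, visitWeight ℓ x w m n • x n‖ ^ 2 := by
        rw [hw.eq_add_smul_sum hk, add_sub_cancel_left, norm_smul, mul_pow, Real.norm_eq_abs,
          sq_abs]
    _ ≤ a ^ 2 * (sigmaMax x ^ 2 * ∑ n, visitWeight ℓ x w m n ^ 2) := by
        refine mul_le_mul_of_nonneg_left (hsum.trans ?_) (sq_nonneg a)
        gcongr
        exact Finset.subset_univ _
    _ = a ^ 2 * sigmaMax x ^ 2 * ∑ n, visitWeight ℓ x w m n ^ 2 := (mul_assoc _ _ _).symm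

theorem sum_add_sq_le (hw : IsEpoch ℓ x a K w m) (hℓ : LipschitzWith β (deriv ℓ)) :
    ∑ n, (visitWeight ℓ x w m n + deriv ℓ ⟪w 0, x n⟫) ^ 2 ≤
      (K * (a * β * sigmaMax x ^ 2)) ^ 2 * ∑ n, visitWeight ℓ x w m n ^ 2 := by
  have hlip : ∀ n, (visitWeight ℓ x w m n + deriv ℓ ⟪w 0, x n⟫) ^ 2 ≤
      (β : ℝ) ^ 2 * ⟪w (m n) - w 0, x n⟫ ^ 2 := fun n => by
    have := pow_le_pow_left₀ (norm_nonneg _) (hℓ.norm_sub_le ⟪w (m n), x n⟫ ⟪w 0, x n⟫) 2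
    rw [mul_pow, Real.norm_eq_abs, Real.norm_eq_abs, sq_abs, sq_abs, ← inner_sub_left] at this
    calc _ = (deriv ℓ ⟪w (m n), x n⟫ - deriv ℓ ⟪w 0, x n⟫) ^ 2 := by rw [visitWeight]; ring
      _ ≤ _ := this
  set Q := ∑ n, visitWeight ℓ x w m n ^ 2
  calc ∑ n, (visitWeight ℓ x w m n + deriv ℓ ⟪w 0, x n⟫) ^ 2
      ≤ (β : ℝ) ^ 2 * ∑ n, ⟪w (m n) - w 0, x n⟫ ^ 2 := by
        rw [Finset.mul_sum]; exact Finset.sum_le_sum fun n _ => hlip n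
    _ ≤ (β : ℝ) ^ 2 * ∑ n, ∑ k ∈ Finset.range K, ⟪w k - w 0, x n⟫ ^ 2 := by
        gcongr with n
        exact Finset.single_le_sum (f := fun k => ⟪w k - w 0, x n⟫ ^ 2)
          (fun k _ => sq_nonneg _) (Finset.mem_range.2 (hw.visit_lt n))
    _ = (β : ℝ) ^ 2 * ∑ k ∈ Finset.range K, ∑ n, ⟪w k - w 0, x n⟫ ^ 2 := by
        rw [Finset.sum_comm]
    _ ≤ (β : ℝ) ^ 2 * ∑ k ∈ Finset.range K, sigmaMax x ^ 2 * (a ^ 2 * sigmaMax x ^ 2 * Q) := by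
        gcongr with k hk
        refine (sum_inner_sq_le x _).trans ?_
        gcongr
        exact hw.norm_sub_sq_le_sum (Finset.mem_range.1 hk).le
    _ = (a * β * sigmaMax x ^ 2) ^ 2 * Q * K := by
        rw [Finset.sum_const, Finset.card_range, nsmul_eq_mul]
        ring
    _ ≤ (a * β * sigmaMax x ^ 2) ^ 2 * Q * K ^ 2 := by
        gcongr
        exact_mod_cast Nat.le_self_pow two_ne_zero K
    _ = (K * (a * β * sigmaMax x ^ 2)) ^ 2 * Q := by ring

theorem sum_visitWeight_sq_le (hw : IsEpoch ℓ x a K w m) (hℓ : LipschitzWith β (deriv ℓ))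
    (ha : 0 ≤ a) (hstep : 2 * K * (a * β * sigmaMax x ^ 2) ≤ 1) :
    ∑ n, visitWeight ℓ x w m n ^ 2 ≤ 4 * derivSq ℓ x (w 0) := by
  have hdev := hw.sum_add_sq_le hℓ
  have hsmall : (K * (a * β * sigmaMax x ^ 2)) ^ 2 ≤ (1 / 2) ^ 2 :=
    pow_le_pow_left₀ (by positivity) (by linarith) 2
  have hsplit : ∑ n, visitWeight ℓ x w m n ^ 2 ≤
      2 * ∑ n, (visitWeight ℓ x w m n + deriv ℓ ⟪w 0, x n⟫) ^ 2 + 2 * derivSq ℓ x (w 0) := by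
    rw [derivSq, Finset.mul_sum, Finset.mul_sum, ← Finset.sum_add_distrib]
    exact Finset.sum_le_sum fun n _ => by
      linarith [sq_nonneg (visitWeight ℓ x w m n + 2 * deriv ℓ ⟪w 0, x n⟫)]
  have hQ : 0 ≤ ∑ n, visitWeight ℓ x w m n ^ 2 := Finset.sum_nonneg fun n _ => sq_nonneg _
  linarith [mul_le_mul_of_nonneg_right hsmall hQ]

theorem norm_sub_sq_le (hw : IsEpoch ℓ x a K w m) (hℓ : LipschitzWith β (deriv ℓ)) (ha : 0 ≤ a)
    (hstep : 2 * K * (a * β * sigmaMax x ^ 2) ≤ 1) {k : ℕ} (hk : k ≤ K) :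
    ‖w k - w 0‖ ^ 2 ≤ 4 * a ^ 2 * sigmaMax x ^ 2 * derivSq ℓ x (w 0) :=
  calc ‖w k - w 0‖ ^ 2 ≤ a ^ 2 * sigmaMax x ^ 2 * ∑ n, visitWeight ℓ x w m n ^ 2 :=
        hw.norm_sub_sq_le_sum hk
    _ ≤ a ^ 2 * sigmaMax x ^ 2 * (4 * derivSq ℓ x (w 0)) := by
        gcongr; exact hw.sum_visitWeight_sq_le hℓ ha hstep
    _ = 4 * a ^ 2 * sigmaMax x ^ 2 * derivSq ℓ x (w 0) := by ring

theorem maxMargin_mul_norm_sub_negGrad_le (hw : IsEpoch ℓ x a K w m)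
    (h : IsSmoothMonotoneLoss ℓ β) (hγ : 0 ≤ maxMargin x) (ha : 0 ≤ a)
    (hstep : 2 * K * (a * β * sigmaMax x ^ 2) ≤ 1) :
    maxMargin x * ‖∑ n, visitWeight ℓ x w m n • x n - negGrad ℓ x (w 0)‖ ≤
      2 * K * a * β * sigmaMax x ^ 3 * ‖negGrad ℓ x (w 0)‖ := by
  have hσ := sigmaMax_nonneg x
  have hsub : ∑ n, visitWeight ℓ x w m n • x n - negGrad ℓ x (w 0) =
      ∑ n, (visitWeight ℓ x w m n + deriv ℓ ⟪w 0, x n⟫) • x n := by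
    simp only [negGrad, neg_smul, add_smul, Finset.sum_neg_distrib, Finset.sum_add_distrib,
      sub_neg_eq_add]
  have hnorm : ‖∑ n, visitWeight ℓ x w m n • x n - negGrad ℓ x (w 0)‖ ^ 2 ≤
      (2 * K * a * β * sigmaMax x ^ 3) ^ 2 * derivSq ℓ x (w 0) :=
    calc _ ≤ sigmaMax x ^ 2 * ∑ n, (visitWeight ℓ x w m n + deriv ℓ ⟪w 0, x n⟫) ^ 2 :=
          hsub ▸ norm_sum_smul_sq_le x _ _
      _ ≤ sigmaMax x ^ 2 *
          ((K * (a * β * sigmaMax x ^ 2)) ^ 2 * (4 * derivSq ℓ x (w 0))) := by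
          gcongr
          refine (hw.sum_add_sq_le h.lipschitz_deriv).trans ?_
          gcongr
          exact hw.sum_visitWeight_sq_le h.lipschitz_deriv ha hstep
      _ = (2 * K * a * β * sigmaMax x ^ 3) ^ 2 * derivSq ℓ x (w 0) := by ring
  refine le_of_sq_le_sq ?_ (by positivity)
  calc (maxMargin x * ‖∑ n, visitWeight ℓ x w m n • x n - negGrad ℓ x (w 0)‖) ^ 2
      ≤ maxMargin x ^ 2 * ((2 * K * a * β * sigmaMax x ^ 3) ^ 2 * derivSq ℓ x (w 0)) := by
        rw [mul_pow]; gcongr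
    _ = (2 * K * a * β * sigmaMax x ^ 3) ^ 2 * (maxMargin x ^ 2 * derivSq ℓ x (w 0)) := by ring
    _ ≤ (2 * K * a * β * sigmaMax x ^ 3) ^ 2 * ‖negGrad ℓ x (w 0)‖ ^ 2 := by
        gcongr; exact h.maxMargin_sq_mul_derivSq_le hγ _
    _ = _ := (mul_pow _ _ _).symm

theorem trainingLoss_le (hw : IsEpoch ℓ x a K w m) (h : IsSmoothMonotoneLoss ℓ β)
    (hγ : 0 < maxMargin x) (ha : 0 ≤ a) (hstep : 2 * K * (a * β * sigmaMax x ^ 2) ≤ 1) :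
    trainingLoss ℓ x (w K) ≤ trainingLoss ℓ x (w 0) -
      a * (1 - 2 * a * β * sigmaMax x ^ 3 * (K + (maxMargin x)⁻¹ * sigmaMax x) / maxMargin x) *
        ‖negGrad ℓ x (w 0)‖ ^ 2 := by
  have herr := hw.maxMargin_mul_norm_sub_negGrad_le h hγ.le ha hstep
  have hdist := hw.norm_sub_sq_le h.lipschitz_deriv ha hstep le_rfl
  have hgrad := h.maxMargin_sq_mul_derivSq_le hγ.le (w 0)
  have hdescent := h.trainingLoss_add_le x (w 0) (w K - w 0)
  rw [add_sub_cancel] at hdescent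
  set γ := maxMargin x
  set σ := sigmaMax x
  set G := negGrad ℓ x (w 0)
  set V := ∑ n, visitWeight ℓ x w m n • x n
  have hinner : a * ‖G‖ ^ 2 - a * (2 * K * a * β * σ ^ 3 / γ) * ‖G‖ ^ 2 ≤ ⟪w K - w 0, G⟫ := by
    have hcs : -(‖V - G‖ * ‖G‖) ≤ ⟪V - G, G⟫ := neg_le_of_abs_le (abs_real_inner_le_norm _ _)
    have hVG : ‖V - G‖ ≤ 2 * K * a * β * σ ^ 3 / γ * ‖G‖ := by
      rw [div_mul_eq_mul_div, le_div_iff₀' hγ]; exact herr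
    calc a * ‖G‖ ^ 2 - a * (2 * K * a * β * σ ^ 3 / γ) * ‖G‖ ^ 2
        = a * (‖G‖ ^ 2 - 2 * K * a * β * σ ^ 3 / γ * ‖G‖ * ‖G‖) := by ring
      _ ≤ a * (‖G‖ ^ 2 + ⟪V - G, G⟫) := by
          gcongr
          linarith [mul_le_mul_of_nonneg_right hVG (norm_nonneg G)]
      _ = ⟪w K - w 0, G⟫ := by
          rw [hw.end_eq, add_sub_cancel_left, real_inner_smul_left, inner_sub_left,
            real_inner_self_eq_norm_sq, add_sub_cancel]
  have hquad : β / 2 * σ ^ 2 * ‖w K - w 0‖ ^ 2 ≤ 2 * a ^ 2 * β * σ ^ 4 / γ ^ 2 * ‖G‖ ^ 2 :=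
    calc β / 2 * σ ^ 2 * ‖w K - w 0‖ ^ 2
        ≤ β / 2 * σ ^ 2 * (4 * a ^ 2 * σ ^ 2 * derivSq ℓ x (w 0)) := by gcongr
      _ = 2 * a ^ 2 * β * σ ^ 4 / γ ^ 2 * (γ ^ 2 * derivSq ℓ x (w 0)) := by field_simp; ring
      _ ≤ 2 * a ^ 2 * β * σ ^ 4 / γ ^ 2 * ‖G‖ ^ 2 := by gcongr
  calc trainingLoss ℓ x (w K) ≤ trainingLoss ℓ x (w 0) -
        (a * ‖G‖ ^ 2 - a * (2 * K * a * β * σ ^ 3 / γ) * ‖G‖ ^ 2) +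
          2 * a ^ 2 * β * σ ^ 4 / γ ^ 2 * ‖G‖ ^ 2 := by linarith
    _ = _ := by field_simp; ring

end IsEpoch

end Epochs

theorem summable_of_descent {L S : ℕ → ℝ} {c : ℝ} (hc : 0 < c) (hL : ∀ t, 0 ≤ L t)
    (hS : ∀ t, 0 ≤ S t) (h : ∀ t, L (t + 1) ≤ L t - c * S t) : Summable S := by
  have hsum : ∀ t, c * ∑ s ∈ Finset.range t, S s ≤ L 0 - L t := fun t => by
    rw [Finset.mul_sum, ← Finset.sum_range_sub']
    exact Finset.sum_le_sum fun s _ => by linarith [h s]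
  refine summable_of_sum_range_le (c := L 0 / c) hS fun t => (le_div_iff₀' hc).2 ?_
  linarith [hsum t, hL t]

theorem abs_log_sub_log_div_le {K : ℕ} (hK : 0 < K) (t : ℕ) :
    |Real.log t - Real.log (t / K : ℕ)| ≤ Real.log (2 * K) := by
  have hmod := Nat.div_add_mod t K
  have hlt := Nat.mod_lt t hK
  have hdiv := Nat.div_le_self t K
  rcases t.eq_zero_or_pos with rfl | ht
  · simpa using Real.log_nonneg (x := 2 * K) (by norm_cast; omega)
  have ht' : (0 : ℝ) < t := by exact_mod_cast ht
  rcases (t / K).eq_zero_or_pos with hzero | hpos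
  · have hle : t ≤ 2 * K := by rw [hzero] at hmod; omega
    rw [hzero, Nat.cast_zero, Real.log_zero, sub_zero, abs_of_nonneg (Real.log_natCast_nonneg t)]
    exact Real.log_le_log ht' (by exact_mod_cast hle)
  · have hpos' : (0 : ℝ) < (t / K : ℕ) := by exact_mod_cast hpos
    have hle : t ≤ 2 * K * (t / K) := by nlinarith
    rw [abs_of_nonneg (sub_nonneg.2 (Real.log_le_log hpos' (by exact_mod_cast hdiv))),
      sub_le_iff_le_add, ← Real.log_mul (by positivity) hpos'.ne']
    exact Real.log_le_log ht' (by exact_mod_cast hle)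

section WithoutReplacement

variable {N d : ℕ} {x : Dataset N d} {ℓ : ℝ → ℝ} {β : ℝ≥0}

theorem SamplesWithoutReplacement.exists_isEpoch {B K : ℕ} (hNKB : N = K * B)
    {batch : ℕ → Finset (Fin N)} (hb : SamplesWithoutReplacement B K batch) (ℓ : ℝ → ℝ)
    (x : Dataset N d) (η : ℝ) (w₀ : Vec d) (u : ℕ) :
    ∃ m, IsEpoch ℓ x (η / B) K (fun k => sgd ℓ x η B batch w₀ (K * u + k)) m := by
  obtain ⟨m, hlt, hmem⟩ := exists_forall_mem_iff_eq_of_biUnion_eq_univ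
    (by rw [Fintype.card_fin, hNKB]) (fun k _ => hb.card_eq (K * u + k)) (hb.epoch u)
  refine ⟨m, hlt, fun k hk => ?_⟩
  have hbatch : batch (K * u + k) = Finset.univ.filter (m · = k) := by
    ext n
    simpa using hmem k hk n
  rw [← hbatch]
  exact sgd_succ ℓ x η B batch w₀ (K * u + k)

variable {a : ℝ} {K : ℕ} {w : ℕ → Vec d} {m : ℕ → Fin N → ℕ}

theorem IsEpoch.summable_derivSq (hw : ∀ u, IsEpoch ℓ x a K (fun k => w (K * u + k)) (m u))
    (h : IsSmoothMonotoneLoss ℓ β) (hγ : 0 < maxMargin x) (ha : 0 < a)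
    (hstep : 2 * K * (a * β * sigmaMax x ^ 2) ≤ 1)
    (hdescent : 2 * a * β * sigmaMax x ^ 3 * (K + (maxMargin x)⁻¹ * sigmaMax x) / maxMargin x < 1) :
    Summable fun u => derivSq ℓ x (w (K * u)) := by
  have hgrad : Summable fun u => ‖negGrad ℓ x (w (K * u))‖ ^ 2 :=
    summable_of_descent (mul_pos ha (sub_pos.2 hdescent))
      (fun u => h.trainingLoss_nonneg x (w (K * u))) (fun _ => sq_nonneg _)
      fun u => (hw u).trainingLoss_le h hγ ha.le hstep
  refine (hgrad.div_const (maxMargin x ^ 2)).of_nonneg_of_le (fun _ => derivSq_nonneg _ _ _)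
    fun u => ?_
  rw [le_div_iff₀' (pow_pos hγ 2)]
  exact h.maxMargin_sq_mul_derivSq_le hγ.le _

theorem IsEpoch.exists_norm_sub_le (hw : ∀ u, IsEpoch ℓ x a K (fun k => w (K * u + k)) (m u))
    (hℓ : LipschitzWith β (deriv ℓ)) (ha : 0 ≤ a)
    (hstep : 2 * K * (a * β * sigmaMax x ^ 2) ≤ 1)
    (hsum : Summable fun u => derivSq ℓ x (w (K * u))) :
    ∃ D, ∀ u, ∀ k ≤ K, ‖w (K * u + k) - w (K * u)‖ ≤ D := by
  refine ⟨√(4 * a ^ 2 * sigmaMax x ^ 2 * ∑' u, derivSq ℓ x (w (K * u))), fun u k hk =>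
    Real.le_sqrt_of_sq_le (((hw u).norm_sub_sq_le hℓ ha hstep hk).trans ?_)⟩
  gcongr
  exact hsum.le_tsum u fun _ _ => derivSq_nonneg _ _ _

theorem IsEpoch.isExpDriven (hw : ∀ u, IsEpoch ℓ x a K (fun k => w (K * u + k)) (m u))
    (h : IsSmoothMonotoneLoss ℓ β)
    (htail : (fun u => -deriv ℓ u) =Θ[atTop] fun u => Real.exp (-u)) (ha : 0 < a)
    (hstep : 2 * K * (a * β * sigmaMax x ^ 2) ≤ 1)
    (hsum : Summable fun u => derivSq ℓ x (w (K * u))) :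
    IsExpDriven x (fun u => w (K * u))
      fun u n => a * visitWeight ℓ x (fun k => w (K * u + k)) (m u) n := by
  obtain ⟨D, hD⟩ := IsEpoch.exists_norm_sub_le hw h.lipschitz_deriv ha.le hstep hsum
  have hvisit : ∀ n, Summable fun u => visitWeight ℓ x (fun k => w (K * u + k)) (m u) n ^ 2 :=
    fun n => (hsum.mul_left 4).of_nonneg_of_le (fun _ => sq_nonneg _) fun u =>
      (Finset.single_le_sum (f := fun n => visitWeight ℓ x (fun k => w (K * u + k)) (m u) n ^ 2)
        (fun _ _ => sq_nonneg _) (Finset.mem_univ n)).trans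
        ((hw u).sum_visitWeight_sq_le h.lipschitz_deriv ha.le hstep)
  refine ⟨fun u => ?_, fun u n => ?_, fun n => ?_, fun n => ?_⟩
  · simpa only [mul_smul, ← Finset.smul_sum, mul_add_one, add_zero] using (hw u).end_eq
  · exact mul_nonneg ha.le (neg_nonneg.2 (h.deriv_neg _).le)
  · refine (h.isTheta_neg_deriv_inner htail (fun u => hD u (m u n) ((hw u).visit_lt n).le)
      ?_).const_mul_left ha.ne'
    simpa only [visitWeight, neg_sq] using hvisit n
  · simpa only [mul_pow] using (hvisit n).mul_left (a ^ 2)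

theorem SamplesWithoutReplacement.exists_norm_residual_le (hγ : 0 < maxMargin x)
    (h : IsSmoothMonotoneLoss ℓ β)
    (htail : (fun u => -deriv ℓ u) =Θ[atTop] fun u => Real.exp (-u)) {what : Vec d}
    {α : Fin N → ℝ} (hα : IsStrictKKTPair x what α) {η : ℝ} (hη : 0 < η) {B : ℕ} (hB : 0 < B)
    (hK : 0 < K) (hNKB : N = K * B)
    (hstep : η / B < min (1 / (2 * K * β * sigmaMax x ^ 2)) (maxMargin x /
      (2 * β * sigmaMax x ^ 3 * (K + (maxMargin x)⁻¹ * sigmaMax x))))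
    {batch : ℕ → Finset (Fin N)} (hb : SamplesWithoutReplacement B K batch) (w₀ : Vec d) :
    ∃ R, ∀ t, ‖residual (sgd ℓ x η B batch w₀) what t‖ ≤ R := by
  have hσ := sigmaMax_pos hγ
  have hβ := h.beta_pos
  have ha : 0 < η / B := by positivity
  obtain ⟨hstep₁, hstep₂⟩ := lt_min_iff.1 hstep
  rw [lt_div_iff₀ (by positivity)] at hstep₁ hstep₂
  have hsmall : 2 * K * (η / B * β * sigmaMax x ^ 2) ≤ 1 := by linarith
  have hdescent : 2 * (η / B) * β * sigmaMax x ^ 3 * (K + (maxMargin x)⁻¹ * sigmaMax x) /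
      maxMargin x < 1 := (div_lt_one hγ).2 (by linarith)
  choose m hw using hb.exists_isEpoch hNKB ℓ x η w₀
  have hsum := IsEpoch.summable_derivSq hw h hγ ha hsmall hdescent
  obtain ⟨D, hD⟩ := IsEpoch.exists_norm_sub_le hw h.lipschitz_deriv ha.le hsmall hsum
  obtain ⟨R, hR⟩ := (IsEpoch.isExpDriven hw h htail ha hsmall hsum).exists_norm_residual_le hα
  set w := sgd ℓ x η B batch w₀
  refine ⟨D + R + Real.log (2 * K) * ‖what‖, fun t => ?_⟩
  have hdist : ‖w t - w (K * (t / K))‖ ≤ D := by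
    simpa only [Nat.div_add_mod] using hD (t / K) (t % K) (Nat.mod_lt t hK).le
  have hlog : ‖(Real.log t - Real.log (t / K : ℕ)) • what‖ ≤ Real.log (2 * K) * ‖what‖ := by
    rw [norm_smul]
    exact mul_le_mul_of_nonneg_right (abs_log_sub_log_div_le hK t) (norm_nonneg _)
  calc ‖residual w what t‖
      = ‖w t - w (K * (t / K)) + residual (fun u => w (K * u)) what (t / K) -
          (Real.log t - Real.log (t / K : ℕ)) • what‖ := by
        congr 1; simp only [residual, sub_smul]; abel
    _ ≤ D + R + Real.log (2 * K) * ‖what‖ :=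
        (norm_sub_le _ _).trans
          (add_le_add ((norm_add_le _ _).trans (add_le_add hdist (hR (t / K)))) hlog)

end WithoutReplacement

section Sampling

variable {N B : ℕ} {Ω : Type*} {batch : ℕ → Ω → Finset (Fin N)} {n : Fin N}

/-- The minibatches drawn before time `t`. A random variable is determined by them if it
`Function.FactorsThrough` this function. -/
def past (batch : ℕ → Ω → Finset (Fin N)) (t : ℕ) (ω : Ω) : Finset.range t → Finset (Fin N) :=
  fun i => batch i ω

/-- The deviation of the indicator that the index `n` is drawn at time `t` from its mean `B / N`. -/
noncomputable def samplingError (batch : ℕ → Ω → Finset (Fin N)) (B : ℕ) (n : Fin N) (t : ℕ)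
    (ω : Ω) : ℝ :=
  (if n ∈ batch t ω then 1 else 0) - (B : ℝ) / N

/-- The accumulated effect of the sampling errors of the index `n`, weighted by `φ`. -/
noncomputable def noise (batch : ℕ → Ω → Finset (Fin N)) (B : ℕ) (n : Fin N) (φ : ℕ → Ω → ℝ)
    (t : ℕ) (ω : Ω) : ℝ :=
  ∑ s ∈ Finset.range t, samplingError batch B n s ω * φ s ω

theorem past_eq_iff {t : ℕ} {ω ω' : Ω} :
    past batch t ω = past batch t ω' ↔ ∀ i < t, batch i ω = batch i ω' :=
  ⟨fun h i hi => congrFun h ⟨i, Finset.mem_range.2 hi⟩,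
    fun h => funext fun i => h i (Finset.mem_range.1 i.2)⟩

theorem past_factorsThrough_past (batch : ℕ → Ω → Finset (Fin N)) {s t : ℕ} (hst : s ≤ t) :
    (past batch s).FactorsThrough (past batch t) := fun _ _ h =>
  past_eq_iff.2 fun i hi => past_eq_iff.1 h i (hi.trans_le hst)

theorem samplingError_factorsThrough (t : ℕ) :
    (samplingError batch B n t).FactorsThrough (past batch (t + 1)) := fun _ _ h => by
  rw [samplingError, samplingError, past_eq_iff.1 h t t.lt_succ_self]

theorem samplingError_mul_factorsThrough {t : ℕ} {φ : Ω → ℝ}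
    (hφ : φ.FactorsThrough (past batch t)) :
    (fun ω => samplingError batch B n t ω * φ ω).FactorsThrough (past batch (t + 1)) :=
  fun _ _ h => congrArg₂ (· * ·) (samplingError_factorsThrough t h)
    (hφ (past_factorsThrough_past batch t.le_succ h))

theorem noise_succ (φ : ℕ → Ω → ℝ) (t : ℕ) (ω : Ω) :
    noise batch B n φ (t + 1) ω = noise batch B n φ t ω + samplingError batch B n t ω * φ t ω :=
  Finset.sum_range_succ _ _

theorem noise_factorsThrough {φ : ℕ → Ω → ℝ} (hφ : ∀ t, (φ t).FactorsThrough (past batch t))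
    (t : ℕ) : (noise batch B n φ t).FactorsThrough (past batch t) := fun _ _ h =>
  Finset.sum_congr rfl fun s hs => samplingError_mul_factorsThrough (hφ s)
    (past_factorsThrough_past batch (Finset.mem_range.1 hs) h)

namespace SamplesWithReplacement

variable [MeasurableSpace Ω] {P : Measure Ω}

theorem measurable_past (h : SamplesWithReplacement P B batch) (t : ℕ) :
    Measurable[_, ⊤] (past batch t) := by
  let _ : MeasurableSpace (Finset.range t → Finset (Fin N)) := ⊤
  refine measurable_to_countable' fun y => ?_
  have hpreimage : past batch t ⁻¹' {y} = ⋂ i : Finset.range t, {ω | batch i ω = y i} := by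
    ext ω
    simp [past, funext_iff]
  rw [hpreimage]
  exact MeasurableSet.iInter fun i => h.measurable i (y i)

/-- The filtration generated by the minibatches. -/
def filtration (h : SamplesWithReplacement P B batch) :
    Filtration ℕ (inferInstance : MeasurableSpace Ω) where
  seq t := MeasurableSpace.comap (past batch t) ⊤
  mono' s t hst := by
    obtain ⟨F, hF⟩ := (Function.factorsThrough_iff _).1 (past_factorsThrough_past batch hst)
    dsimp only
    rw [hF, ← MeasurableSpace.comap_comp]
    exact MeasurableSpace.comap_mono le_top
  le' t := (h.measurable_past t).comap_le

theorem stronglyMeasurable_of_factorsThrough (h : SamplesWithReplacement P B batch) {t : ℕ}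
    {φ : Ω → ℝ} (hφ : φ.FactorsThrough (past batch t)) :
    StronglyMeasurable[h.filtration t] φ := by
  obtain ⟨F, rfl⟩ := (Function.factorsThrough_iff φ).1 hφ
  let _ : MeasurableSpace (Finset.range t → Finset (Fin N)) := ⊤
  exact (measurable_from_top.comp (comap_measurable (past batch t))).stronglyMeasurable

theorem indep_samplingError_filtration (h : SamplesWithReplacement P B batch) (n : Fin N)
    (t : ℕ) :
    Indep (MeasurableSpace.comap (samplingError batch B n t) inferInstance) (h.filtration t) P := by
  let _ : MeasurableSpace (Finset (Fin N)) := ⊤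
  have : DiscreteMeasurableSpace (Finset (Fin N)) := ⟨fun _ => trivial⟩
  have hmeas : ∀ i, Measurable (batch i) := fun i =>
    measurable_to_countable' fun y => h.measurable i y
  have hind := iIndepFun.indepFun_finset {t} (Finset.range t) (by simp) h.indep hmeas
  let error (y : ({t} : Finset ℕ) → Finset (Fin N)) : ℝ :=
    (if n ∈ y ⟨t, Finset.mem_singleton_self t⟩ then 1 else 0) - (B : ℝ) / N
  exact hind.comp (φ := error) (_mγ' := ⊤) (ψ := id) .of_discrete
    (@Measurable.of_discrete _ _ _ ⊤ _ _)

theorem integral_samplingError [IsProbabilityMeasure P] (h : SamplesWithReplacement P B batch)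
    (n : Fin N) (t : ℕ) : ∫ ω, samplingError batch B n t ω ∂P = 0 := by
  have hset : MeasurableSet {ω | n ∈ batch t ω} := by
    have : {ω | n ∈ batch t ω} = ⋃ s : {s : Finset (Fin N) // n ∈ s}, {ω | batch t ω = s} := by
      ext ω; simp
    rw [this]
    exact MeasurableSet.iUnion fun s => h.measurable t s
  have herror : samplingError batch B n t =
      fun ω => {ω | n ∈ batch t ω}.indicator 1 ω - (B : ℝ) / N := by
    ext ω; simp [samplingError, Set.indicator_apply]
  rw [herror, integral_sub ((integrable_const 1).indicator hset) (integrable_const _),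
    integral_indicator_one hset, h.uniform]
  simp

variable [IsProbabilityMeasure P]

theorem integrable_of_factorsThrough (h : SamplesWithReplacement P B batch) {t : ℕ} {φ : Ω → ℝ}
    (hφ : φ.FactorsThrough (past batch t)) : Integrable φ P := by
  have hmeas := (h.stronglyMeasurable_of_factorsThrough hφ).mono (h.filtration.le t)
  obtain ⟨F, rfl⟩ := (Function.factorsThrough_iff φ).1 hφ
  exact .of_bound hmeas.aestronglyMeasurable (∑ y, ‖F y‖) <| Eventually.of_forall fun ω =>
    Finset.single_le_sum (f := fun y => ‖F y‖) (fun _ _ => norm_nonneg _) (Finset.mem_univ _)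

theorem condExp_samplingError_mul (h : SamplesWithReplacement P B batch) (n : Fin N) {t : ℕ}
    {φ : Ω → ℝ} (hφ : φ.FactorsThrough (past batch t)) :
    P[fun ω => samplingError batch B n t ω * φ ω | h.filtration t] =ᵐ[P] 0 := by
  have herror := condExp_indep_eq (Measurable.comap_le ?_) (h.filtration.le t)
    (comap_measurable _).stronglyMeasurable (h.indep_samplingError_filtration n t)
  · rw [h.integral_samplingError] at herror
    filter_upwards [herror, condExp_mul_of_stronglyMeasurable_right
      (h.stronglyMeasurable_of_factorsThrough hφ)
      (h.integrable_of_factorsThrough (samplingError_mul_factorsThrough hφ))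
      (h.integrable_of_factorsThrough (samplingError_factorsThrough (B := B) (n := n) t))]
      with ω hω hmul
    exact hmul.trans (by simp [hω])
  · exact ((h.stronglyMeasurable_of_factorsThrough (samplingError_factorsThrough t)).mono
      (h.filtration.le _)).measurable

theorem integral_samplingError_mul (h : SamplesWithReplacement P B batch) (n : Fin N) {t : ℕ}
    {φ : Ω → ℝ} (hφ : φ.FactorsThrough (past batch t)) :
    ∫ ω, samplingError batch B n t ω * φ ω ∂P = 0 := by
  rw [← integral_condExp (h.filtration.le t), integral_congr_ae (h.condExp_samplingError_mul n hφ)]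
  simp

theorem martingale_noise (h : SamplesWithReplacement P B batch) (n : Fin N) {φ : ℕ → Ω → ℝ}
    (hφ : ∀ t, (φ t).FactorsThrough (past batch t)) :
    Martingale (noise batch B n φ) h.filtration P := by
  refine martingale_of_condExp_sub_eq_zero_nat
    (fun t => h.stronglyMeasurable_of_factorsThrough (noise_factorsThrough hφ t))
    (fun t => h.integrable_of_factorsThrough (noise_factorsThrough hφ t)) fun t => ?_
  have hincrement : noise batch B n φ (t + 1) - noise batch B n φ t =
      fun ω => samplingError batch B n t ω * φ t ω := by
    ext ω
    rw [Pi.sub_apply, noise_succ, add_sub_cancel_left]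
  rw [hincrement]
  exact h.condExp_samplingError_mul n (hφ t)

theorem abs_samplingError_le_one (h : SamplesWithReplacement P B batch) (n : Fin N) (t : ℕ)
    (ω : Ω) : |samplingError batch B n t ω| ≤ 1 := by
  have hq : (B : ℝ) / N ≤ 1 := h.uniform t n ▸ measureReal_le_one
  have hq' : 0 ≤ (B : ℝ) / N := by positivity
  rw [samplingError, abs_le]
  split_ifs <;> constructor <;> linarith

theorem integral_noise_sq_le (h : SamplesWithReplacement P B batch) (n : Fin N) {φ : ℕ → Ω → ℝ}
    (hφ : ∀ t, (φ t).FactorsThrough (past batch t)) (t : ℕ) :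
    ∫ ω, noise batch B n φ t ω ^ 2 ∂P ≤ ∑ s ∈ Finset.range t, ∫ ω, φ s ω ^ 2 ∂P := by
  induction t with
  | zero => simp [noise]
  | succ t ih =>
    set M := noise batch B n φ with hM
    have hMφ : (fun ω => M t ω * φ t ω).FactorsThrough (past batch t) := fun _ _ he =>
      congrArg₂ (· * ·) (noise_factorsThrough hφ t he) (hφ t he)
    have hint : ∀ s, Integrable (fun ω => M s ω ^ 2) P := fun s =>
      h.integrable_of_factorsThrough ((noise_factorsThrough hφ s).comp_left (· ^ 2))
    have hφint : Integrable (fun ω => φ t ω ^ 2) P :=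
      h.integrable_of_factorsThrough ((hφ t).comp_left (· ^ 2))
    have hsum : Integrable (fun ω => M t ω ^ 2 + φ t ω ^ 2) P := (hint t).add hφint
    have hcross : Integrable (fun ω => samplingError batch B n t ω * (M t ω * φ t ω)) P :=
      h.integrable_of_factorsThrough (samplingError_mul_factorsThrough hMφ)
    have hpointwise : ∀ ω, M (t + 1) ω ^ 2 ≤
        M t ω ^ 2 + φ t ω ^ 2 + 2 * (samplingError batch B n t ω * (M t ω * φ t ω)) := fun ω => by
      have herror := (sq_le_one_iff_abs_le_one _).2 (h.abs_samplingError_le_one n t ω)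
      rw [hM, noise_succ]
      linarith [mul_le_mul_of_nonneg_right herror (sq_nonneg (φ t ω))]
    calc ∫ ω, M (t + 1) ω ^ 2 ∂P
        ≤ ∫ ω, (M t ω ^ 2 + φ t ω ^ 2 +
            2 * (samplingError batch B n t ω * (M t ω * φ t ω))) ∂P :=
          integral_mono (hint _) (hsum.add (hcross.const_mul 2)) hpointwise
      _ = ∫ ω, M t ω ^ 2 ∂P + ∫ ω, φ t ω ^ 2 ∂P := by
          rw [integral_add hsum (hcross.const_mul 2), integral_const_mul,
            h.integral_samplingError_mul n hMφ, mul_zero, add_zero, integral_add (hint t) hφint]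
      _ ≤ ∑ s ∈ Finset.range (t + 1), ∫ ω, φ s ω ^ 2 ∂P := by
          rw [Finset.sum_range_succ]; gcongr

theorem ae_bounded_noise (h : SamplesWithReplacement P B batch) (n : Fin N) {φ : ℕ → Ω → ℝ}
    (hφ : ∀ t, (φ t).FactorsThrough (past batch t))
    (hsum : Summable fun t => ∫ ω, φ t ω ^ 2 ∂P) :
    ∀ᵐ ω ∂P, ∃ C, ∀ t, |noise batch B n φ t ω| ≤ C := by
  set M := noise batch B n φ
  have hfactors : ∀ t, (M t).FactorsThrough (past batch t) := noise_factorsThrough hφ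
  have hbdd : ∀ t, eLpNorm (M t) 1 P ≤ ((1 + ∑' t, ∫ ω, φ t ω ^ 2 ∂P).toNNReal : ℝ≥0∞) := by
    intro t
    have hint := h.integrable_of_factorsThrough (hfactors t)
    have hsq : Integrable (fun ω => M t ω ^ 2) P :=
      h.integrable_of_factorsThrough ((hfactors t).comp_left (· ^ 2))
    rw [eLpNorm_one_eq_lintegral_enorm, ← ofReal_integral_norm_eq_lintegral_enorm hint]
    refine ENNReal.ofReal_le_ofReal ?_
    calc ∫ ω, ‖M t ω‖ ∂P ≤ ∫ ω, (1 + M t ω ^ 2) ∂P := by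
          refine integral_mono hint.norm ((integrable_const 1).add hsq) fun ω => ?_
          dsimp only
          rw [Real.norm_eq_abs, ← sq_abs]
          nlinarith [sq_nonneg (|M t ω| - 1)]
      _ = 1 + ∫ ω, M t ω ^ 2 ∂P := by
          rw [integral_add (integrable_const 1) hsq]; simp
      _ ≤ 1 + ∑' t, ∫ ω, φ t ω ^ 2 ∂P := by
          gcongr
          exact (h.integral_noise_sq_le n hφ t).trans (hsum.sum_le_tsum _ fun _ _ =>
            integral_nonneg fun _ => sq_nonneg _)
  filter_upwards [(h.martingale_noise n hφ).submartingale.exists_ae_tendsto_of_bdd hbdd]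
    with ω ⟨c, hc⟩
  obtain ⟨C, hC⟩ := hc.abs.bddAbove_range
  exact ⟨C, fun t => hC ⟨t, rfl⟩⟩

end SamplesWithReplacement

end Sampling

section WithReplacement

variable {N d : ℕ} {x : Dataset N d} {ℓ : ℝ → ℝ} {β : ℝ≥0}

/-- The contribution of the point `x n` to an upper bound on the change of the training loss in a
minibatch step with step size `a`. -/
noncomputable def lossIncrement (ℓ : ℝ → ℝ) (β : ℝ≥0) (x : Dataset N d) (a : ℝ) (w : Vec d)
    (n : Fin N) : ℝ :=
  β / 2 * sigmaMax x ^ 4 * a ^ 2 * deriv ℓ ⟪w, x n⟫ ^ 2 -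
    a * (-deriv ℓ ⟪w, x n⟫ * ⟪x n, negGrad ℓ x w⟫)

namespace IsSmoothMonotoneLoss

theorem trainingLoss_add_smul_sum_le (h : IsSmoothMonotoneLoss ℓ β) (x : Dataset N d) (a : ℝ)
    (b : Finset (Fin N)) (w : Vec d) :
    trainingLoss ℓ x (w + a • ∑ n ∈ b, (-deriv ℓ ⟪w, x n⟫) • x n) ≤
      trainingLoss ℓ x w + ∑ n ∈ b, lossIncrement ℓ β x a w n := by
  have hdescent := h.trainingLoss_add_le x w (a • ∑ n ∈ b, (-deriv ℓ ⟪w, x n⟫) • x n)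
  have hnorm := norm_sum_smul_sq_le x b fun n => -deriv ℓ ⟪w, x n⟫
  set V := ∑ n ∈ b, (-deriv ℓ ⟪w, x n⟫) • x n with hV
  have hinner : ⟪a • V, negGrad ℓ x w⟫ =
      ∑ n ∈ b, a * (-deriv ℓ ⟪w, x n⟫ * ⟪x n, negGrad ℓ x w⟫) := by
    simp only [hV, real_inner_smul_left, sum_inner, Finset.mul_sum]
  have hquad : β / 2 * sigmaMax x ^ 2 * ‖a • V‖ ^ 2 ≤
      ∑ n ∈ b, β / 2 * sigmaMax x ^ 4 * a ^ 2 * deriv ℓ ⟪w, x n⟫ ^ 2 :=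
    calc β / 2 * sigmaMax x ^ 2 * ‖a • V‖ ^ 2
        = β / 2 * sigmaMax x ^ 2 * a ^ 2 * ‖V‖ ^ 2 := by
          rw [norm_smul, mul_pow, Real.norm_eq_abs, sq_abs]; ring
      _ ≤ β / 2 * sigmaMax x ^ 2 * a ^ 2 * (sigmaMax x ^ 2 * ∑ n ∈ b, (-deriv ℓ ⟪w, x n⟫) ^ 2) := by
          gcongr
      _ = ∑ n ∈ b, β / 2 * sigmaMax x ^ 4 * a ^ 2 * deriv ℓ ⟪w, x n⟫ ^ 2 := by
          simp only [neg_sq, ← Finset.mul_sum]; ring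
  simp only [lossIncrement, Finset.sum_sub_distrib]
  linarith

theorem sum_lossIncrement_le (h : IsSmoothMonotoneLoss ℓ β) (hγ : 0 ≤ maxMargin x) {a : ℝ}
    (ha : 0 ≤ a) (w : Vec d) :
    ∑ n, lossIncrement ℓ β x a w n ≤
      -(a * (maxMargin x ^ 2 - a * β * sigmaMax x ^ 4 / 2) * derivSq ℓ x w) := by
  have hinner : ∑ n, -deriv ℓ ⟪w, x n⟫ * ⟪x n, negGrad ℓ x w⟫ = ‖negGrad ℓ x w‖ ^ 2 := by
    simp only [← real_inner_smul_left, ← sum_inner]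
    exact real_inner_self_eq_norm_sq _
  calc ∑ n, lossIncrement ℓ β x a w n
      = β / 2 * sigmaMax x ^ 4 * a ^ 2 * derivSq ℓ x w - a * ‖negGrad ℓ x w‖ ^ 2 := by
        simp only [lossIncrement, Finset.sum_sub_distrib, ← Finset.mul_sum, hinner, derivSq]
    _ ≤ β / 2 * sigmaMax x ^ 4 * a ^ 2 * derivSq ℓ x w -
          a * (maxMargin x ^ 2 * derivSq ℓ x w) := by
        gcongr; exact h.maxMargin_sq_mul_derivSq_le hγ w
    _ = -(a * (maxMargin x ^ 2 - a * β * sigmaMax x ^ 4 / 2) * derivSq ℓ x w) := by ring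

end IsSmoothMonotoneLoss

variable {Ω : Type*} {B : ℕ} {batch : ℕ → Ω → Finset (Fin N)} {η : ℝ} {w₀ : Vec d}

/-- The SGD iterates for random minibatches. -/
noncomputable def randomSGD (ℓ : ℝ → ℝ) (x : Dataset N d) (η : ℝ) (B : ℕ)
    (batch : ℕ → Ω → Finset (Fin N)) (w₀ : Vec d) (t : ℕ) (ω : Ω) : Vec d :=
  sgd ℓ x η B (fun s => batch s ω) w₀ t

/-- The part of the SGD iterates caused by the sampling errors of the minibatches. -/
noncomputable def sgdNoise (ℓ : ℝ → ℝ) (x : Dataset N d) (η : ℝ) (B : ℕ)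
    (batch : ℕ → Ω → Finset (Fin N)) (w₀ : Vec d) (t : ℕ) (ω : Ω) : Vec d :=
  (η / B) • ∑ n,
    noise batch B n (fun s ω => -deriv ℓ ⟪randomSGD ℓ x η B batch w₀ s ω, x n⟫) t ω • x n

theorem sum_batch_eq {E : Type*} [AddCommGroup E] [Module ℝ E]
    (batch : ℕ → Ω → Finset (Fin N)) (B t : ℕ) (ω : Ω) (y : Fin N → E) :
    ∑ n ∈ batch t ω, y n =
      ((B : ℝ) / N) • ∑ n, y n + ∑ n, samplingError batch B n t ω • y n := by
  simp [samplingError, sub_smul, ← Finset.smul_sum]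

theorem randomSGD_factorsThrough (ℓ : ℝ → ℝ) (x : Dataset N d) (η : ℝ) (B : ℕ)
    (batch : ℕ → Ω → Finset (Fin N)) (w₀ : Vec d) (t : ℕ) :
    (randomSGD ℓ x η B batch w₀ t).FactorsThrough (past batch t) := fun ω ω' h => by
  induction t with
  | zero => rfl
  | succ t ih =>
    have hprev := ih (past_factorsThrough_past batch t.le_succ h)
    simp only [randomSGD] at hprev ⊢
    rw [sgd, sgd, hprev, past_eq_iff.1 h t t.lt_succ_self]

theorem randomSGD_succ_sub_sgdNoise_succ (t : ℕ) (ω : Ω) :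
    randomSGD ℓ x η B batch w₀ (t + 1) ω - sgdNoise ℓ x η B batch w₀ (t + 1) ω =
      randomSGD ℓ x η B batch w₀ t ω - sgdNoise ℓ x η B batch w₀ t ω +
        ∑ n, (η / B * (B / N) * -deriv ℓ ⟪randomSGD ℓ x η B batch w₀ t ω, x n⟫) • x n := by
  have hstep : randomSGD ℓ x η B batch w₀ (t + 1) ω = randomSGD ℓ x η B batch w₀ t ω +
      (η / B) • ∑ n ∈ batch t ω, (-deriv ℓ ⟪randomSGD ℓ x η B batch w₀ t ω, x n⟫) • x n :=
    sgd_succ _ _ _ _ _ _ _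
  rw [hstep, sum_batch_eq batch B]
  simp only [sgdNoise, noise_succ, add_smul, mul_smul, Finset.sum_add_distrib, smul_add,
    ← Finset.smul_sum]
  abel

variable [MeasurableSpace Ω] {P : Measure Ω}

theorem ae_summable_of_summable_integral {S : ℕ → Ω → ℝ} (hint : ∀ t, Integrable (S t) P)
    (hnonneg : ∀ t ω, 0 ≤ S t ω) (hsum : Summable fun t => ∫ ω, S t ω ∂P) :
    ∀ᵐ ω ∂P, Summable fun t => S t ω := by
  have hmeas : ∀ t, AEMeasurable (fun ω => ENNReal.ofReal (S t ω)) P := fun t =>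
    (hint t).aemeasurable.ennreal_ofReal
  have hlintegral : ∫⁻ ω, ∑' t, ENNReal.ofReal (S t ω) ∂P ≠ ∞ := by
    simp only [lintegral_tsum hmeas, ← ofReal_integral_eq_lintegral_ofReal (hint _)
      (Eventually.of_forall (hnonneg _))]
    exact hsum.tsum_ofReal_ne_top
  filter_upwards [ae_lt_top' (AEMeasurable.tsum hmeas) hlintegral] with ω hω
  simpa only [ENNReal.toReal_ofReal (hnonneg _ ω)] using ENNReal.summable_toReal hω.ne

namespace SamplesWithReplacement

variable [IsProbabilityMeasure P]

theorem integrable_comp_randomSGD (hb : SamplesWithReplacement P B batch) (f : Vec d → ℝ)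
    (t : ℕ) : Integrable (fun ω => f (randomSGD ℓ x η B batch w₀ t ω)) P :=
  hb.integrable_of_factorsThrough ((randomSGD_factorsThrough ℓ x η B batch w₀ t).comp_left f)

theorem integral_trainingLoss_succ_le (hb : SamplesWithReplacement P B batch)
    (h : IsSmoothMonotoneLoss ℓ β) (hγ : 0 ≤ maxMargin x) (hη : 0 ≤ η / B) (t : ℕ) :
    ∫ ω, trainingLoss ℓ x (randomSGD ℓ x η B batch w₀ (t + 1) ω) ∂P ≤
      ∫ ω, trainingLoss ℓ x (randomSGD ℓ x η B batch w₀ t ω) ∂P -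
        B / N * (η / B * (maxMargin x ^ 2 - η / B * β * sigmaMax x ^ 4 / 2)) *
          ∫ ω, derivSq ℓ x (randomSGD ℓ x η B batch w₀ t ω) ∂P := by
  set c := (B : ℝ) / N * (η / B * (maxMargin x ^ 2 - η / B * β * sigmaMax x ^ 4 / 2)) with hc
  set w := randomSGD ℓ x η B batch w₀
  let e (n : Fin N) (ω : Ω) : ℝ :=
    samplingError batch B n t ω * lossIncrement ℓ β x (η / B) (w t ω) n
  have hint : ∀ (f : Vec d → ℝ) s, Integrable (fun ω => f (w s ω)) P := fun f s =>
    hb.integrable_comp_randomSGD f s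
  have hfactors : ∀ n, (fun ω => lossIncrement ℓ β x (η / B) (w t ω) n).FactorsThrough
      (past batch t) := fun n =>
    (randomSGD_factorsThrough ℓ x η B batch w₀ t).comp_left (lossIncrement ℓ β x (η / B) · n)
  have he : ∀ n, Integrable (e n) P := fun n =>
    hb.integrable_of_factorsThrough (samplingError_mul_factorsThrough (hfactors n))
  have hsum : Integrable (fun ω => ∑ n, e n ω) P := integrable_finsetSum _ fun n _ => he n
  have hmean : Integrable (fun ω => trainingLoss ℓ x (w t ω) - c * derivSq ℓ x (w t ω)) P :=
    hint (fun v => trainingLoss ℓ x v - c * derivSq ℓ x v) t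
  have hpointwise : ∀ ω, trainingLoss ℓ x (w (t + 1) ω) ≤
      trainingLoss ℓ x (w t ω) - c * derivSq ℓ x (w t ω) + ∑ n, e n ω := fun ω => by
    have hloss := h.trainingLoss_add_smul_sum_le x (η / B) (batch t ω) (w t ω)
    rw [sum_batch_eq batch B t ω (lossIncrement ℓ β x _ _)] at hloss
    have hincrement := mul_le_mul_of_nonneg_left (h.sum_lossIncrement_le hγ hη (w t ω))
      (by positivity : 0 ≤ (B : ℝ) / N)
    calc trainingLoss ℓ x (w (t + 1) ω) = _ := congrArg _ (sgd_succ _ _ _ _ _ _ _)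
      _ ≤ _ := hloss
      _ ≤ _ := by simp only [smul_eq_mul, e, hc]; linarith
  calc ∫ ω, trainingLoss ℓ x (w (t + 1) ω) ∂P
      ≤ ∫ ω, (trainingLoss ℓ x (w t ω) - c * derivSq ℓ x (w t ω) + ∑ n, e n ω) ∂P :=
        integral_mono (hint _ _) (hmean.add hsum) hpointwise
    _ = ∫ ω, trainingLoss ℓ x (w t ω) ∂P - c * ∫ ω, derivSq ℓ x (w t ω) ∂P := by
        rw [integral_add hmean hsum, integral_finsetSum _ fun n _ => he n,
          Finset.sum_eq_zero fun n _ => hb.integral_samplingError_mul n (hfactors n), add_zero,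
          integral_sub (hint _ t) ((hint _ t).const_mul c), integral_const_mul]

theorem summable_integral_derivSq (hb : SamplesWithReplacement P B batch)
    (h : IsSmoothMonotoneLoss ℓ β) (hγ : 0 < maxMargin x) (hη : 0 < η) (hB : 0 < B)
    (hstep : η / B < 2 * maxMargin x ^ 2 / (β * sigmaMax x ^ 4)) (w₀ : Vec d) :
    Summable fun t => ∫ ω, derivSq ℓ x (randomSGD ℓ x η B batch w₀ t ω) ∂P := by
  have hσ := sigmaMax_pos hγ
  have hβ := h.beta_pos
  have hN := pos_of_maxMargin_pos hγ
  have hdescent : 0 < maxMargin x ^ 2 - η / B * β * sigmaMax x ^ 4 / 2 := by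
    rw [lt_div_iff₀ (by positivity)] at hstep
    linarith
  exact summable_of_descent (by positivity)
    (fun t => integral_nonneg fun ω => h.trainingLoss_nonneg x _)
    (fun t => integral_nonneg fun ω => derivSq_nonneg _ _ _)
    (hb.integral_trainingLoss_succ_le h hγ.le (by positivity))

theorem ae_exists_norm_sgdNoise_le (hb : SamplesWithReplacement P B batch)
    (hsum : Summable fun t => ∫ ω, derivSq ℓ x (randomSGD ℓ x η B batch w₀ t ω) ∂P) :
    ∀ᵐ ω ∂P, ∃ F, ∀ t, ‖sgdNoise ℓ x η B batch w₀ t ω‖ ≤ F := by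
  set w := randomSGD ℓ x η B batch w₀
  have hnoise : ∀ n, ∀ᵐ ω ∂P, ∃ C, ∀ t,
      |noise batch B n (fun s ω => -deriv ℓ ⟪w s ω, x n⟫) t ω| ≤ C := fun n => by
    refine hb.ae_bounded_noise n (fun t =>
      (randomSGD_factorsThrough ℓ x η B batch w₀ t).comp_left fun v => -deriv ℓ ⟪v, x n⟫)
      (hsum.of_nonneg_of_le (fun t => integral_nonneg fun ω => sq_nonneg _) fun t => ?_)
    refine integral_mono (hb.integrable_comp_randomSGD (fun v => (-deriv ℓ ⟪v, x n⟫) ^ 2) t)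
      (hb.integrable_comp_randomSGD _ t) fun ω => ?_
    simp only [neg_sq]
    exact sq_deriv_le_derivSq ℓ x _ n
  filter_upwards [ae_all_iff.2 hnoise] with ω hω
  choose C hC using hω
  refine ⟨|η / B| * ∑ n, C n * ‖x n‖, fun t => ?_⟩
  rw [sgdNoise, norm_smul, Real.norm_eq_abs]
  gcongr
  refine norm_sum_le_of_le _ fun n _ => ?_
  rw [norm_smul]
  gcongr
  exact hC n t

theorem ae_exists_norm_residual_le (hb : SamplesWithReplacement P B batch)
    (hγ : 0 < maxMargin x) (h : IsSmoothMonotoneLoss ℓ β)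
    (htail : (fun u => -deriv ℓ u) =Θ[atTop] fun u => Real.exp (-u)) {what : Vec d}
    {α : Fin N → ℝ} (hα : IsStrictKKTPair x what α) (hη : 0 < η) (hB : 0 < B)
    (hstep : η / B < 2 * maxMargin x ^ 2 / (β * sigmaMax x ^ 4)) (w₀ : Vec d) :
    ∀ᵐ ω ∂P, ∃ R, ∀ t, ‖residual (sgd ℓ x η B (fun s => batch s ω) w₀) what t‖ ≤ R := by
  have hN := pos_of_maxMargin_pos hγ
  have hsum := hb.summable_integral_derivSq h hγ hη hB hstep w₀
  filter_upwards [hb.ae_exists_norm_sgdNoise_le hsum, ae_summable_of_summable_integral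
    (hb.integrable_comp_randomSGD (derivSq ℓ x)) (fun _ _ => derivSq_nonneg _ _ _) hsum]
    with ω ⟨F, hF⟩ hsumω
  have hderiv : ∀ n, Summable fun t => deriv ℓ ⟪randomSGD ℓ x η B batch w₀ t ω, x n⟫ ^ 2 :=
    fun n => hsumω.of_nonneg_of_le (fun _ => sq_nonneg _) fun _ => sq_deriv_le_derivSq ℓ x _ n
  have hdriven : IsExpDriven x
      (fun t => randomSGD ℓ x η B batch w₀ t ω - sgdNoise ℓ x η B batch w₀ t ω)
      fun t n => η / B * (B / N) * -deriv ℓ ⟪randomSGD ℓ x η B batch w₀ t ω, x n⟫ := by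
    refine ⟨fun t => randomSGD_succ_sub_sgdNoise_succ t ω, fun t n => ?_, fun n => ?_,
      fun n => ?_⟩
    · exact mul_nonneg (by positivity) (neg_nonneg.2 (h.deriv_neg _).le)
    · exact (h.isTheta_neg_deriv_inner htail (fun t => by simpa using hF t)
        (hderiv n)).const_mul_left (by positivity)
    · simpa only [mul_pow (η / B * (B / N) : ℝ), neg_sq] using
        (hderiv n).mul_left ((η / B * (B / N)) ^ 2)
  obtain ⟨R, hR⟩ := hdriven.exists_norm_residual_le hα
  refine ⟨R + F, fun t => ?_⟩
  calc ‖residual (sgd ℓ x η B (fun s => batch s ω) w₀) what t‖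
      = ‖residual (fun t => randomSGD ℓ x η B batch w₀ t ω - sgdNoise ℓ x η B batch w₀ t ω) what t
          + sgdNoise ℓ x η B batch w₀ t ω‖ := by
        simp only [residual, randomSGD]; congr 1; abel
    _ ≤ R + F := (norm_add_le _ _).trans (add_le_add (hR t) (hF t))

end SamplesWithReplacement

end WithReplacement

end SGDMaxMargin

theorem theorem2_general (N d : ℕ) (hN : 0 < N) :
    ∀ᵐ x : SGDMaxMargin.Dataset N d, SGDMaxMargin.LinearlySeparable x →
      (∃! what, SGDMaxMargin.IsHardMarginSVM x what) ∧
      ∀ what, SGDMaxMargin.IsHardMarginSVM x what →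
      ∀ (ℓ : ℝ → ℝ) (β : ℝ≥0), SGDMaxMargin.IsSmoothMonotoneLoss ℓ β →
      ((fun u => -deriv ℓ u) =Θ[atTop] fun u => Real.exp (-u)) →
      ∀ (B K : ℕ), N = K * B → ∀ (η : ℝ), 0 < η → ∀ w₀ : SGDMaxMargin.Vec d,
        (η / B < 2 * SGDMaxMargin.maxMargin x ^ 2 / (β * SGDMaxMargin.sigmaMax x ^ 4) →
          ∀ (Ω : Type*) [MeasurableSpace Ω] (P : Measure Ω) [IsProbabilityMeasure P]
            (batch : ℕ → Ω → Finset (Fin N)),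
            SGDMaxMargin.SamplesWithReplacement P B batch →
            ∀ᵐ ω ∂P, SGDMaxMargin.ConvergesToSVM ℓ x what η B K
              (SGDMaxMargin.sgd ℓ x η B (fun t => batch t ω) w₀)) ∧
        (η / B < min (1 / (2 * K * β * SGDMaxMargin.sigmaMax x ^ 2))
            (SGDMaxMargin.maxMargin x / (2 * β * SGDMaxMargin.sigmaMax x ^ 3 *
              (K + (SGDMaxMargin.maxMargin x)⁻¹ * SGDMaxMargin.sigmaMax x))) →
          ∀ batch : ℕ → Finset (Fin N),
            SGDMaxMargin.SamplesWithoutReplacement B K batch →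
            SGDMaxMargin.ConvergesToSVM ℓ x what η B K
              (SGDMaxMargin.sgd ℓ x η B batch w₀)) := by
  filter_upwards [SGDMaxMargin.ae_exists_isStrictKKTPair] with x hgen hx
  have hγ := SGDMaxMargin.maxMargin_pos hN hx
  refine ⟨SGDMaxMargin.existsUnique_isHardMarginSVM hγ, ?_⟩
  intro what hwhat ℓ β h htail B K hNKB η hη w₀
  obtain ⟨α, hα⟩ := hgen hγ what hwhat
  have hKB : 0 < K * B := hNKB ▸ hN
  have hK : 0 < K := Nat.pos_of_mul_pos_right hKB
  have hB : 0 < B := Nat.pos_of_mul_pos_left hKB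
  have hconv {u : ℕ → SGDMaxMargin.Vec d} {R : ℝ} :
      (∀ t, ‖SGDMaxMargin.residual u what t‖ ≤ R) →
        SGDMaxMargin.ConvergesToSVM ℓ x what η B K u :=
    h.convergesToSVM htail.1.of_neg_left hwhat.1 hN hη hB hK
  constructor
  · intro hstep Ω _ P _ batch hb
    filter_upwards [hb.ae_exists_norm_residual_le hγ h htail hα hη hB hstep w₀] with ω ⟨R, hR⟩
    exact hconv hR
  · intro hstep batch hb
    obtain ⟨R, hR⟩ := hb.exists_norm_residual_le hγ h htail hα hη hB hK hNKB hstep w₀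
    exact hconv hR

theorem theorem2 (N d : ℕ) (hN : 0 < N) :
    ∀ᵐ x : SGDMaxMargin.Dataset N d, SGDMaxMargin.LinearlySeparable x →
      (∃! what, SGDMaxMargin.IsHardMarginSVM x what) ∧
      ∀ what, SGDMaxMargin.IsHardMarginSVM x what →
      ∀ (ℓ : ℝ → ℝ) (β : ℝ≥0), SGDMaxMargin.IsSmoothMonotoneLoss ℓ β →
      SGDMaxMargin.HasTightExponentialTail (fun u => -deriv ℓ u) →
      ∀ (B K : ℕ), N = K * B → ∀ (η : ℝ), 0 < η → ∀ w₀ : SGDMaxMargin.Vec d,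
        -- random sampling with replacement
        (η / B < 2 * SGDMaxMargin.maxMargin x ^ 2 / (β * SGDMaxMargin.sigmaMax x ^ 4) →
          ∀ (Ω : Type*) [MeasurableSpace Ω] (P : Measure Ω) [IsProbabilityMeasure P]
            (batch : ℕ → Ω → Finset (Fin N)),
            SGDMaxMargin.SamplesWithReplacement P B batch →
            ∀ᵐ ω ∂P, SGDMaxMargin.ConvergesToSVM ℓ x what η B K
              (SGDMaxMargin.sgd ℓ x η B (fun t => batch t ω) w₀)) ∧
        -- sampling without replacement
        (η / B < min (1 / (2 * K * β * SGDMaxMargin.sigmaMax x ^ 2))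
            (SGDMaxMargin.maxMargin x / (2 * β * SGDMaxMargin.sigmaMax x ^ 3 *
              (K + (SGDMaxMargin.maxMargin x)⁻¹ * SGDMaxMargin.sigmaMax x))) →
          ∀ batch : ℕ → Finset (Fin N),
            SGDMaxMargin.SamplesWithoutReplacement B K batch →
            SGDMaxMargin.ConvergesToSVM ℓ x what η B K
              (SGDMaxMargin.sgd ℓ x η B batch w₀)) := by
  filter_upwards [theorem2_general N d hN] with x hgen hx
  exact ⟨(hgen hx).1, fun what hwhat ℓ β h htail => (hgen hx).2 what hwhat ℓ β h htail.isTheta⟩
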